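/- **Setting.** Let $(B',g')$ and $(\widetilde B,\widetilde g)$ be nonempty smooth pseudo-Riemannian manifolds (without boundary, arbitrary signature) of dimensions $n'$ and $\widetilde n$; each of them may itself be a finite product of pseudo-Riemannian manifolds. Put $B=B'\times\widetilde B$, $g=g'+\widetilde g$, $n=n'+\widetilde n$. Let $f'\colon B'\to(0,\infty)$ and $\widetilde f\colon\widetilde B\to(0,\infty)$ be smooth and $f(x,y)=f'(x)+\widetilde f(y)$. Let $F=\mathbb R^d+E$ be a derived manifold: $\mathbb R^d$ with the flat metric $\ddot g=-\delta_{ij}$ together with a smooth vector bundle $E\to\mathbb R^d$ of obstructions, of virtual dimension $m=d-\operatorname{rank}E$, where $m=-d<0$. All Riemannian operations on $F$ are, by definition, those of the underlying $(\mathbb R^d,\ddot g)$; in particular the warped product $(M,\bar g)=(B,g)\times_f(F,\ddot g)$ carries the metric $\bar g=g+f^2\ddot g$ on $B\times\mathbb R^d$. Let $\lambda\in\mathbb R$. Here $\nabla^2$ and $\Delta=\operatorname{tr}\nabla^2$ are the Hessian and the Laplacian, $|\nabla f|^2=g(\nabla f,\nabla f)$, and primes, tildes, double dots and bars refer to $B'$,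 $\widetilde B$, $F$ and $M$. **Definition.** $(M,\bar g)$ is a *PNDP-manifold with constant $\lambda$* if $\overline{Ric}=\lambda\bar g$, $\widetilde{Ric}=\lambda\widetilde g$, $\operatorname{rank}E>d$, $m=-d$, and the following normalization (N) holds: if $n-d>0$, then $n'=d$, and if in addition $Ric'=\lambda g'$, then $(B',g')$ and $(\widetilde B,\widetilde g)$ are isometric. **Theorem.** (a) Consider the system $$ Ric'-\frac df\nabla'^2f'=\lambda g',\qquad \widetilde\nabla^2\widetilde f=0,\qquad \widetilde{Ric}=\lambda\widetilde g,\qquad \ddot{Ric}=0,\qquad f\Delta'f'+(d-1)|\nabla f|^2+\lambda f^2=0, \tag{T} $$ where the first and the last equation are required at all points of $B$. Then $(M,\bar g)$ is a PNDP-manifold with constant $\lambda$ if and only if (N) and (T) hold. Without the normalization: $\overline{Ric}=\lambda\bar g$ and $\widetilde{Ric}=\lambda\widetilde g$ hold together if and only if (T) holds. If (T) holds, then the Ricci tensor of $B$ is $Ric=Ric'+\widetilde{Ric}=\lambda(g'+\widetilde g)+\frac df\nabla'^2f'$ (pullbacks to $B$ understood). (b) Let $R$, $R'$, $\widetilde R$,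 $\bar R$ be the scalar curvatures of $B$, $B'$, $\widetilde B$, $M$. Put $k=d$ if $n-d\le 0$; if $n-d>0$, assume $d=n'$ and put $k=n'$. Consider the contracted system $$ R'f-k\,\Delta'f'=n'f\lambda,\qquad \widetilde\Delta\widetilde f=0,\qquad \widetilde R=\lambda\widetilde n,\qquad \ddot{Ric}=0,\qquad f\Delta'f'+(k-1)|\nabla f|^2+\lambda f^2=0. \tag{S} $$ Then: 1. (T) implies (S). 2. (S) holds if and only if $\widetilde R=\lambda\widetilde n$ and the equation $\overline{Ric}=\lambda\bar g$ holds after contraction over each of the three factors $B'$, $\widetilde B$, $F$, i.e. the traces of the restrictions of $\overline{Ric}$ to these factors, with respect to the restrictions of $\bar g$, are $\lambda n'$, $\lambda\widetilde n$, $\lambda d$. 3. If $\widetilde R=\lambda\widetilde n$ and $\widetilde\Delta\widetilde f=0$, then (S) is equivalent to the two equations $Rf^2-d\,f\Delta f=nf^2\lambda$ and $d\,f\Delta f+d(d-1)|\nabla f|^2+\lambda f^2d=0$ on $B$. 4. (S) implies $\bar R=\lambda(n+d)$, where $n+d$ is the dimension of the underlying manifold $B\times\mathbb R^d$. -/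

import Mathlib

open Bundle Module
open scoped Manifold ContDiff

set_option maxSynthPendingDepth 3

noncomputable section

/-! ## Linear algebra: traces and gradients with respect to a nondegenerate bilinear form -/

section LinearAlgebra

variable {V W : Type*} [AddCommGroup V] [Module ℝ V] [AddCommGroup W] [Module ℝ W]

open Classical in
/-- The trace `gⁱʲ bᵢⱼ` of a bilinear form `b` with respect to a nondegenerate bilinear form `g`,
i.e. the trace of the endomorphism obtained from `b` by raising an index with `g`. -/
def metricTrace [FiniteDimensional ℝ V] (g b : LinearMap.BilinForm ℝ V) : ℝ :=
  if hg : g.Nondegenerate then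
    LinearMap.trace ℝ V ((LinearMap.BilinForm.toDual g hg).symm.toLinearMap ∘ₗ b)
  else 0

/-- The pullback `b(A ·, A ·)` of a bilinear form along a linear map. -/
abbrev pullForm (b : LinearMap.BilinForm ℝ W) (A : V →ₗ[ℝ] W) : LinearMap.BilinForm ℝ V :=
  b.comp A A

end LinearAlgebra

/-! ## Curvature in coordinates

`E` is a finite-dimensional coordinate space and `G : E → (E →L[ℝ] E →L[ℝ] ℝ)` is a field of
bilinear forms, the metric `g_{ij}` in a chart. -/

namespace Coord

variable {E : Type*} [NormedAddCommGroup E] [NormedSpace ℝ E]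

/-- Flipping the arguments of a continuous bilinear form, as a continuous linear map. -/
def flipCLM (E : Type*) [NormedAddCommGroup E] [NormedSpace ℝ E] :
    (E →L[ℝ] E →L[ℝ] ℝ) →L[ℝ] (E →L[ℝ] E →L[ℝ] ℝ) :=
  ((ContinuousLinearMap.flipₗᵢ ℝ E E ℝ).toContinuousLinearEquiv :
    (E →L[ℝ] E →L[ℝ] ℝ) →L[ℝ] (E →L[ℝ] E →L[ℝ] ℝ))

/-- Christoffel symbols of the first kind:
`u v w ↦ ½ (∂ᵤ G(v,w) + ∂ᵥ G(u,w) - ∂_w G(u,v))`. -/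
def christoffelFst (G : E → E →L[ℝ] E →L[ℝ] ℝ) (x : E) : E →L[ℝ] E →L[ℝ] E →L[ℝ] ℝ :=
  (1 / 2 : ℝ) •
    (fderiv ℝ G x + (fderiv ℝ G x).flip - (flipCLM E).comp (fderiv ℝ G x).flip)

lemma christoffelFst_apply (G : E → E →L[ℝ] E →L[ℝ] ℝ) (x u v w : E) :
    christoffelFst G x u v w =
      1 / 2 * (fderiv ℝ G x u v w + fderiv ℝ G x v u w - fderiv ℝ G x w u v) := rfl

/-- Christoffel symbols of the second kind, `Γ(u,v) = uⁱ vʲ Γᵢⱼᵏ eₖ`: the index `w` of the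
symbols of the first kind is raised with `G`. -/
def christoffel (G : E → E →L[ℝ] E →L[ℝ] ℝ) (x : E) : E →L[ℝ] E →L[ℝ] E :=
  (ContinuousLinearMap.compL ℝ E (E →L[ℝ] ℝ) E (G x).inverse).comp (christoffelFst G x)

lemma christoffel_apply (G : E → E →L[ℝ] E →L[ℝ] ℝ) (x u v : E) :
    christoffel G x u v = (G x).inverse (christoffelFst G x u v) := rfl

/-- The endomorphism `u ↦ R(u,v)w`, where `R` is the Riemann curvature tensor. -/
def riemann (G : E → E →L[ℝ] E →L[ℝ] ℝ) (x v w : E) : E →L[ℝ] E :=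
  ((fderiv ℝ (christoffel G) x).flip v).flip w - (fderiv ℝ (christoffel G) x v).flip w
    + (christoffel G x).flip (christoffel G x v w)
    - (christoffel G x v).comp ((christoffel G x).flip w)

lemma riemann_apply (G : E → E →L[ℝ] E →L[ℝ] ℝ) (x u v w : E) :
    riemann G x v w u =
      fderiv ℝ (christoffel G) x u v w - fderiv ℝ (christoffel G) x v u w
        + christoffel G x u (christoffel G x v w) - christoffel G x v (christoffel G x u w) := rfl

/-- The Ricci tensor `Ric(v,w) = tr (u ↦ R(u,v)w)`. -/
def ricci (G : E → E →L[ℝ] E →L[ℝ] ℝ) (x : E) : LinearMap.BilinForm ℝ E :=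
  LinearMap.mk₂ ℝ (fun v w => LinearMap.trace ℝ E (riemann G x v w).toLinearMap)
    (fun v v' w => by
      rw [← map_add]; congr 1; ext u
      simp only [ContinuousLinearMap.coe_coe, LinearMap.add_apply, riemann_apply,
        map_add, add_apply]
      abel)
    (fun c v w => by
      rw [← map_smul]; congr 1; ext u
      simp only [ContinuousLinearMap.coe_coe, LinearMap.smul_apply, riemann_apply,
        map_smul, smul_apply, smul_sub, smul_add])
    (fun v w w' => by
      rw [← map_add]; congr 1; ext u
      simp only [ContinuousLinearMap.coe_coe, LinearMap.add_apply, riemann_apply,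
        map_add]
      abel)
    (fun c v w => by
      rw [← map_smul]; congr 1; ext u
      simp only [ContinuousLinearMap.coe_coe, LinearMap.smul_apply, riemann_apply,
        map_smul, smul_sub, smul_add])

/-- The Hessian `∇²φ(u,v) = ∂ᵤ∂ᵥφ - dφ(Γ(u,v))`. -/
def hessian (G : E → E →L[ℝ] E →L[ℝ] ℝ) (φ : E → ℝ) (x : E) : LinearMap.BilinForm ℝ E :=
  LinearMap.mk₂ ℝ
    (fun u v => fderiv ℝ (fderiv ℝ φ) x u v - fderiv ℝ φ x (christoffel G x u v))
    (fun u u' v => by simp; ring) (fun c u v => by simp; ring)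
    (fun u v v' => by simp; ring) (fun c u v => by simp; ring)

end Coord

/-! ## Pseudo-Riemannian manifolds -/

section Manifold

variable {E : Type*} [NormedAddCommGroup E] [NormedSpace ℝ E] [FiniteDimensional ℝ E]
  {H : Type*} [TopologicalSpace H] {I : ModelWithCorners ℝ E H}
  {M : Type*} [TopologicalSpace M] [ChartedSpace H M]

instance tangentSpace_finiteDimensional (x : M) : FiniteDimensional ℝ (TangentSpace I x) :=
  inferInstanceAs (FiniteDimensional ℝ E)

variable (I) in
/-- A field of bilinear forms `b` on the tangent spaces, written in the chart at `p`: the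
bilinear form `b_{φ⁻¹(x)}(d(φ⁻¹)ₓ ·, d(φ⁻¹)ₓ ·)` on `E`, where `φ` is the chart at `p`. -/
def inChart (b : ∀ x : M, LinearMap.BilinForm ℝ (TangentSpace I x)) (p : M) (x : E) :
    E →L[ℝ] E →L[ℝ] ℝ :=
  LinearMap.toContinuousBilinearMap
    (pullForm (b ((extChartAt I p).symm x))
      (mfderiv 𝓘(ℝ, E) I (extChartAt I p).symm x).toLinearMap : LinearMap.BilinForm ℝ E)

variable (I M) in
/-- A smooth pseudo-Riemannian metric: a symmetric nondegenerate bilinear form on every tangent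
space, whose components are smooth in the (preferred) charts
around all points; smoothness in all other charts of the atlas follows. The signature is arbitrary. -/
structure PseudoRiemannianMetric where
  /-- the scalar product on the tangent space at `x` -/
  form : ∀ x : M, LinearMap.BilinForm ℝ (TangentSpace I x)
  symm : ∀ (x : M) (v w : TangentSpace I x), form x v w = form x w v
  nondegenerate : ∀ x : M, (form x).Nondegenerate
  smooth : ∀ (p : M) (u v : E),
    ContDiffOn ℝ ∞ (fun x => inChart I form p x u v) (extChartAt I p).target

namespace PseudoRiemannianMetric

variable (g : PseudoRiemannianMetric I M)

/-- The Ricci tensor at `p`, computed in the chart at `p` and transported to the tangent space. -/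
def ricci (p : M) : LinearMap.BilinForm ℝ (TangentSpace I p) :=
  pullForm (W := E) (Coord.ricci (inChart I g.form p) (extChartAt I p p))
    (mfderiv I 𝓘(ℝ, E) (extChartAt I p) p).toLinearMap

/-- The Hessian `∇²f` at `p`, computed in the chart at `p` and transported to the tangent space. -/
def hessian (f : M → ℝ) (p : M) : LinearMap.BilinForm ℝ (TangentSpace I p) :=
  pullForm (W := E)
    (Coord.hessian (inChart I g.form p) (f ∘ (extChartAt I p).symm) (extChartAt I p p))
    (mfderiv I 𝓘(ℝ, E) (extChartAt I p) p).toLinearMap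

/-- The gradient `∇f`, i.e. the vector with `g(∇f, v) = df(v)` for all `v`. -/
def grad (f : M → ℝ) (p : M) : TangentSpace I p :=
  (LinearMap.BilinForm.toDual (g.form p) (g.nondegenerate p)).symm
    (mfderiv I 𝓘(ℝ, ℝ) f p).toLinearMap

/-- `|∇f|² = g(∇f, ∇f)` (it may be negative if `g` is indefinite). -/
def gradSq (f : M → ℝ) (p : M) : ℝ := g.form p (g.grad f p) (g.grad f p)

/-- The Laplacian, the trace of the Hessian. -/
def laplacian (f : M → ℝ) (p : M) : ℝ := metricTrace (g.form p) (g.hessian f p)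

/-- The scalar curvature, the trace of the Ricci tensor. -/
def scal (p : M) : ℝ := metricTrace (g.form p) (g.ricci p)

/-- The Einstein condition `Ric = lam g`, with a given constant `lam`. -/
def IsEinstein (lam : ℝ) : Prop := ∀ p : M, g.ricci p = lam • g.form p

end PseudoRiemannianMetric

variable (I M) in
/-- Smooth positive functions. -/
structure PosFun where
  toFun : M → ℝ
  smooth : ContMDiff I 𝓘(ℝ, ℝ) ∞ toFun
  pos : ∀ x, 0 < toFun x

instance : CoeFun (PosFun I M) (fun _ => M → ℝ) := ⟨PosFun.toFun⟩

/-- The constant function `1`. -/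
def PosFun.one : PosFun I M := ⟨fun _ => 1, contMDiff_const, fun _ => one_pos⟩

end Manifold

/-! ## Products and warped products -/

section Products

variable {E : Type*} [NormedAddCommGroup E] [NormedSpace ℝ E] [FiniteDimensional ℝ E]
  {H : Type*} [TopologicalSpace H] {I : ModelWithCorners ℝ E H}
  {M : Type*} [TopologicalSpace M] [ChartedSpace H M]
  {E' : Type*} [NormedAddCommGroup E'] [NormedSpace ℝ E'] [FiniteDimensional ℝ E']
  {H' : Type*} [TopologicalSpace H'] {J : ModelWithCorners ℝ E' H'}
  {N : Type*} [TopologicalSpace N] [ChartedSpace H' N]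

/-- The function `(x, y) ↦ f x + h y` on a product. -/
def PosFun.sum (f : PosFun I M) (h : PosFun J N) : PosFun (I.prod J) (M × N) where
  toFun p := f p.1 + h p.2
  smooth := (f.smooth.comp contMDiff_fst).add (h.smooth.comp contMDiff_snd)
  pos _ := add_pos (f.pos _) (h.pos _)

variable (I J) in
/-- Pullback, under the first projection, of a bilinear form at `p.1`. -/
def pullFst (p : M × N) (b : LinearMap.BilinForm ℝ (TangentSpace I p.1)) :
    LinearMap.BilinForm ℝ (TangentSpace (I.prod J) p) :=
  pullForm b (mfderiv (I.prod J) I (Prod.fst : M × N → M) p).toLinearMap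

variable (I J) in
/-- Pullback, under the second projection, of a bilinear form at `p.2`. -/
def pullSnd (p : M × N) (b : LinearMap.BilinForm ℝ (TangentSpace J p.2)) :
    LinearMap.BilinForm ℝ (TangentSpace (I.prod J) p) :=
  pullForm b (mfderiv (I.prod J) J (Prod.snd : M × N → N) p).toLinearMap

/-- The form `π^* g + f² σ^* h` on `M × N`, where `π`, `σ` are the two projections. -/
def warpedForm (g : PseudoRiemannianMetric I M) (f : PosFun I M) (h : PseudoRiemannianMetric J N) (p : M × N) :
    LinearMap.BilinForm ℝ (TangentSpace (I.prod J) p) :=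
  pullFst I J p (g.form p.1) + f p.1 ^ 2 • pullSnd I J p (h.form p.2)

lemma warpedForm_apply (g : PseudoRiemannianMetric I M) (f : PosFun I M)
    (h : PseudoRiemannianMetric J N) (p : M × N) (v w : TangentSpace (I.prod J) p) :
    warpedForm g f h p v w =
      g.form p.1 (mfderiv (I.prod J) I (Prod.fst : M × N → M) p v)
          (mfderiv (I.prod J) I (Prod.fst : M × N → M) p w)
        + f p.1 ^ 2 * h.form p.2 (mfderiv (I.prod J) J (Prod.snd : M × N → N) p v)
          (mfderiv (I.prod J) J (Prod.snd : M × N → N) p w) := rfl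

set_option linter.unusedSectionVars false in
lemma mfderiv_fst_snd_ext (p : M × N) (v : TangentSpace (I.prod J) p)
    (h₁ : mfderiv (I.prod J) I (Prod.fst : M × N → M) p v = 0)
    (h₂ : mfderiv (I.prod J) J (Prod.snd : M × N → N) p v = 0) : v = 0 := by
  rw [mfderiv_fst] at h₁
  rw [mfderiv_snd] at h₂
  exact Prod.ext (α := E) (β := E') h₁ h₂

set_option linter.unusedSectionVars false in
lemma exists_mfderiv_fst_snd (p : M × N) (a : TangentSpace I p.1) (b : TangentSpace J p.2) :
    ∃ v : TangentSpace (I.prod J) p,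
      mfderiv (I.prod J) I (Prod.fst : M × N → M) p v = a ∧
      mfderiv (I.prod J) J (Prod.snd : M × N → N) p v = b := by
  rw [mfderiv_fst, mfderiv_snd]
  exact ⟨((a, b) : E × E'), rfl, rfl⟩

lemma inChart_warpedForm [I.Boundaryless] [J.Boundaryless] [IsManifold I ∞ M] [IsManifold J ∞ N]
    (g : PseudoRiemannianMetric I M) (f : PosFun I M) (h : PseudoRiemannianMetric J N)
    (p : M × N) (x u v : E × E') (hx : x ∈ (extChartAt (I.prod J) p).target) :
    inChart (I.prod J) (warpedForm g f h) p x u v =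
      inChart I g.form p.1 x.1 u.1 v.1
        + f ((extChartAt I p.1).symm x.1) ^ 2 * inChart J h.form p.2 x.2 u.2 v.2 := by
  have hx' : x.1 ∈ (extChartAt I p.1).target ∧ x.2 ∈ (extChartAt J p.2).target := by
    rw [extChartAt_prod] at hx; exact hx
  have d : MDifferentiableAt 𝓘(ℝ, E × E') (I.prod J) (extChartAt (I.prod J) p).symm x :=
    ((contMDiffOn_extChartAt_symm (n := ∞) p).contMDiffAt
      ((isOpen_extChartAt_target p).mem_nhds hx)).mdifferentiableAt (by simp)
  have d₁ : MDifferentiableAt 𝓘(ℝ, E) I (extChartAt I p.1).symm x.1 :=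
    ((contMDiffOn_extChartAt_symm (n := ∞) p.1).contMDiffAt
      ((isOpen_extChartAt_target p.1).mem_nhds hx'.1)).mdifferentiableAt (by simp)
  have d₂ : MDifferentiableAt 𝓘(ℝ, E') J (extChartAt J p.2).symm x.2 :=
    ((contMDiffOn_extChartAt_symm (n := ∞) p.2).contMDiffAt
      ((isOpen_extChartAt_target p.2).mem_nhds hx'.2)).mdifferentiableAt (by simp)
  have e₁ : ∀ w : E × E', mfderiv (I.prod J) I (Prod.fst : M × N → M)
      ((extChartAt (I.prod J) p).symm x)
      (mfderiv 𝓘(ℝ, E × E') (I.prod J) (extChartAt (I.prod J) p).symm x w)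
      = mfderiv 𝓘(ℝ, E) I (extChartAt I p.1).symm x.1 w.1 := by
    intro w
    have c₁ := mfderiv_comp x (I := 𝓘(ℝ, E × E')) (I' := I.prod J) (I'' := I)
      (g := (Prod.fst : M × N → M)) mdifferentiableAt_fst d
    have c₂ := mfderiv_comp x (I := 𝓘(ℝ, E × E')) (I' := 𝓘(ℝ, E)) (I'' := I)
      (f := (Prod.fst : E × E' → E)) d₁ differentiableAt_fst.mdifferentiableAt
    have c₃ : (Prod.fst : M × N → M) ∘ (extChartAt (I.prod J) p).symm
        = (extChartAt I p.1).symm ∘ (Prod.fst : E × E' → E) := by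
      rw [extChartAt_prod]; rfl
    rw [c₃, c₂] at c₁
    have := congrArg (fun L => L w) c₁
    rw [mfderiv_eq_fderiv, fderiv_fst] at this
    exact this.symm
  have e₂ : ∀ w : E × E', mfderiv (I.prod J) J (Prod.snd : M × N → N)
      ((extChartAt (I.prod J) p).symm x)
      (mfderiv 𝓘(ℝ, E × E') (I.prod J) (extChartAt (I.prod J) p).symm x w)
      = mfderiv 𝓘(ℝ, E') J (extChartAt J p.2).symm x.2 w.2 := by
    intro w
    have c₁ := mfderiv_comp x (I := 𝓘(ℝ, E × E')) (I' := I.prod J) (I'' := J)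
      (g := (Prod.snd : M × N → N)) mdifferentiableAt_snd d
    have c₂ := mfderiv_comp x (I := 𝓘(ℝ, E × E')) (I' := 𝓘(ℝ, E')) (I'' := J)
      (f := (Prod.snd : E × E' → E')) d₂ differentiableAt_snd.mdifferentiableAt
    have c₃ : (Prod.snd : M × N → N) ∘ (extChartAt (I.prod J) p).symm
        = (extChartAt J p.2).symm ∘ (Prod.snd : E × E' → E') := by
      rw [extChartAt_prod]; rfl
    rw [c₃, c₂] at c₁
    have := congrArg (fun L => L w) c₁
    rw [mfderiv_eq_fderiv, fderiv_snd] at this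
    exact this.symm
  change warpedForm g f h ((extChartAt (I.prod J) p).symm x) _ _ = _
  rw [warpedForm_apply]
  erw [e₁ u, e₁ v, e₂ u, e₂ v]
  rw [extChartAt_prod]
  rfl

/-- The warped product metric `g + f² h` of `(M, g) ×_f (N, h)`. -/
def warped [I.Boundaryless] [J.Boundaryless] [IsManifold I ∞ M] [IsManifold J ∞ N]
    (g : PseudoRiemannianMetric I M) (f : PosFun I M) (h : PseudoRiemannianMetric J N) :
    PseudoRiemannianMetric (I.prod J) (M × N) where
  form := warpedForm g f h
  symm p v w := by
    rw [warpedForm_apply, warpedForm_apply, g.symm, h.symm]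
  nondegenerate p := by
    have key : ∀ v : TangentSpace (I.prod J) p,
        (∀ w, warpedForm g f h p v w = 0) → v = 0 := by
      intro v hv
      refine mfderiv_fst_snd_ext p v ((g.nondegenerate p.1).1 _ fun a => ?_)
        ((h.nondegenerate p.2).1 _ fun b => ?_)
      · obtain ⟨w, h₁, h₂⟩ := exists_mfderiv_fst_snd (I := I) (J := J) p a 0
        have := hv w
        rw [warpedForm_apply, h₁, h₂] at this
        simpa using this
      · obtain ⟨w, h₁, h₂⟩ := exists_mfderiv_fst_snd (I := I) (J := J) p 0 b
        have := hv w
        rw [warpedForm_apply, h₁, h₂] at this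
        simpa [(f.pos p.1).ne'] using this
    refine ⟨key, fun w hw => key w fun v => ?_⟩
    rw [warpedForm_apply, g.symm, h.symm, ← warpedForm_apply]
    exact hw v
  smooth p u v := by
    refine ContDiffOn.congr ?_ fun x hx => inChart_warpedForm g f h p x u v hx
    have ht : (extChartAt (I.prod J) p).target
        = (extChartAt I p.1).target ×ˢ (extChartAt J p.2).target := by
      rw [extChartAt_prod]; rfl
    rw [ht]
    have hf : ContDiffOn ℝ ∞ (fun y => f ((extChartAt I p.1).symm y))
        (extChartAt I p.1).target :=
      contMDiffOn_iff_contDiffOn.1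
        (f.smooth.comp_contMDiffOn (contMDiffOn_extChartAt_symm p.1))
    exact ((g.smooth p.1 u.1 v.1).comp contDiffOn_fst fun x hx => hx.1).add
      (((hf.comp contDiffOn_fst fun x hx => hx.1).pow 2).mul
        ((h.smooth p.2 u.2 v.2).comp contDiffOn_snd fun x hx => hx.2))

/-- The product metric `g + h` on `M × N` (the warping function is `1`). -/
def prodMetric [I.Boundaryless] [J.Boundaryless] [IsManifold I ∞ M] [IsManifold J ∞ N]
    (g : PseudoRiemannianMetric I M) (h : PseudoRiemannianMetric J N) :
    PseudoRiemannianMetric (I.prod J) (M × N) :=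
  warped g PosFun.one h

/-- Two pseudo-Riemannian manifolds are isometric. -/
def IsIsometricTo (g : PseudoRiemannianMetric I M) (h : PseudoRiemannianMetric J N) : Prop :=
  ∃ Φ : M ≃ₘ^∞⟮I, J⟯ N, ∀ p : M,
    pullForm (h.form (Φ p)) (mfderiv I J Φ p).toLinearMap = g.form p

/-- For a map `ι : N → M` (below: the inclusion of a factor of a product) and a metric `g` on `M`,
the contraction of the restricted Ricci tensor `ι^* Ric` with the restricted metric `ι^* g`. -/
def contractedRicci (g : PseudoRiemannianMetric I M) (ι : N → M) (q : N) : ℝ :=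
  metricTrace (pullForm (g.form (ι q)) (mfderiv J I ι q).toLinearMap)
    (pullForm (g.ricci (ι q)) (mfderiv J I ι q).toLinearMap)

end Products

/-! ## The derived fiber `ℝᵈ + E` -/

/-- The derived manifold `F = ℝᵈ + E`: Euclidean space together with a smooth vector bundle of
obstructions `E → ℝᵈ` of finite rank. -/
structure DerivedFiber.{u} (d : ℕ) where
  /-- the model fiber of the obstruction bundle -/
  Model : Type u
  [normedAddCommGroup : NormedAddCommGroup Model]
  [normedSpace : NormedSpace ℝ Model]
  [finiteDimensional : FiniteDimensional ℝ Model]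
  /-- the fibers of the obstruction bundle -/
  Obstruction : EuclideanSpace ℝ (Fin d) → Type u
  [topologicalSpaceTotal : TopologicalSpace (TotalSpace Model Obstruction)]
  [addCommGroup : ∀ x, AddCommGroup (Obstruction x)]
  [module : ∀ x, Module ℝ (Obstruction x)]
  [topologicalSpace : ∀ x, TopologicalSpace (Obstruction x)]
  [fiberBundle : FiberBundle Model Obstruction]
  [vectorBundle : VectorBundle ℝ Model Obstruction]
  [contMDiffVectorBundle : ContMDiffVectorBundle ∞ Model Obstruction (𝓡 d)]

namespace DerivedFiber

variable {d : ℕ} (F : DerivedFiber d)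

/-- The rank of the obstruction bundle. -/
def rank : ℕ := letI := F.normedAddCommGroup; letI := F.normedSpace; finrank ℝ F.Model

/-- The (virtual) dimension `m = d - rank E` of `F = ℝᵈ + E`. -/
def virtualDim : ℤ := d - F.rank

/-- The metric of `F`: by definition the flat metric `g_{ij} = -δ_{ij}` of the underlying `ℝᵈ`.
All Riemannian operations on `F` are those of the underlying `ℝᵈ`. -/
def metric (_F : DerivedFiber d) :
    PseudoRiemannianMetric (𝓡 d) (EuclideanSpace ℝ (Fin d)) where
  form _ := -(innerₗ (EuclideanSpace ℝ (Fin d)))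
  symm _ v w := by
    change -(inner ℝ (v : EuclideanSpace ℝ (Fin d)) w) = -(inner ℝ w v)
    rw [real_inner_comm]
  nondegenerate _ := by
    constructor
    · intro v hv
      have h : -(inner ℝ (v : EuclideanSpace ℝ (Fin d)) v) = 0 := hv v
      exact inner_self_eq_zero.1 (neg_eq_zero.1 h)
    · intro v hv
      have h : -(inner ℝ (v : EuclideanSpace ℝ (Fin d)) v) = 0 := hv v
      exact inner_self_eq_zero.1 (neg_eq_zero.1 h)
  smooth p u v := by
    refine (contDiffOn_const (c := -(inner ℝ u v))).congr fun x _ => ?_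
    have h : mfderiv 𝓘(ℝ, EuclideanSpace ℝ (Fin d)) (𝓡 d) (extChartAt (𝓡 d) p).symm x
        = ContinuousLinearMap.id ℝ _ := by
      rw [extChartAt_model_space_eq_id]
      exact mfderiv_id (I := 𝓡 d)
    change -(inner ℝ (mfderiv 𝓘(ℝ, EuclideanSpace ℝ (Fin d)) (𝓡 d)
        (extChartAt (𝓡 d) p).symm x u)
      (mfderiv 𝓘(ℝ, EuclideanSpace ℝ (Fin d)) (𝓡 d) (extChartAt (𝓡 d) p).symm x v)) = _
    rw [h]
    rfl

end DerivedFiber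

/-! ## PNDP-manifolds

The base is `B = B' × B~` with metric `g' + g~`; `E₁`, `E₂` are the model spaces of `B'`, `B~`,
so that `n' = finrank ℝ E₁`, `n~ = finrank ℝ E₂` and `n = n' + n~`. -/

section PNDP

variable {E₁ : Type*} [NormedAddCommGroup E₁] [NormedSpace ℝ E₁] [FiniteDimensional ℝ E₁]
  {H₁ : Type*} [TopologicalSpace H₁] {I₁ : ModelWithCorners ℝ E₁ H₁} [I₁.Boundaryless]
  {B₁ : Type*} [TopologicalSpace B₁] [ChartedSpace H₁ B₁] [IsManifold I₁ ∞ B₁]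
  {E₂ : Type*} [NormedAddCommGroup E₂] [NormedSpace ℝ E₂] [FiniteDimensional ℝ E₂]
  {H₂ : Type*} [TopologicalSpace H₂] {I₂ : ModelWithCorners ℝ E₂ H₂} [I₂.Boundaryless]
  {B₂ : Type*} [TopologicalSpace B₂] [ChartedSpace H₂ B₂] [IsManifold I₂ ∞ B₂]
  {d : ℕ}

/-- The warped product `(B' × B~, g' + g~) ×_f (F, g_F)` with `f(x,y) = f'(x) + f~(y)`. -/
def pndpMetric (g₁ : PseudoRiemannianMetric I₁ B₁) (g₂ : PseudoRiemannianMetric I₂ B₂)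
    (f₁ : PosFun I₁ B₁) (f₂ : PosFun I₂ B₂) (F : DerivedFiber d) :
    PseudoRiemannianMetric ((I₁.prod I₂).prod (𝓡 d)) ((B₁ × B₂) × EuclideanSpace ℝ (Fin d)) :=
  warped (prodMetric g₁ g₂) (f₁.sum f₂) F.metric

/-- The normalizations in the case `n - d > 0`: then `n' = d`; and if moreover `B'` is Einstein
with the same constant `lam`, then `B' = B~` (as pseudo-Riemannian manifolds). -/
def Normalized (g₁ : PseudoRiemannianMetric I₁ B₁) (g₂ : PseudoRiemannianMetric I₂ B₂)
    (d : ℕ) (lam : ℝ) : Prop :=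
  d < finrank ℝ E₁ + finrank ℝ E₂ →
    finrank ℝ E₁ = d ∧ (g₁.IsEinstein lam → IsIsometricTo g₁ g₂)

/-- `(B' × B~) ×_f F` is a PNDP-manifold with Einstein constant `lam`. -/
structure IsPNDP (g₁ : PseudoRiemannianMetric I₁ B₁) (g₂ : PseudoRiemannianMetric I₂ B₂)
    (f₁ : PosFun I₁ B₁) (f₂ : PosFun I₂ B₂) (F : DerivedFiber d) (lam : ℝ) : Prop where
  rank_gt : d < F.rank
  virtualDim_eq : F.virtualDim = -(d : ℤ)
  virtualDim_neg : F.virtualDim < 0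
  normalized : Normalized g₁ g₂ d lam
  einstein_factor : g₂.IsEinstein lam
  einstein : (pndpMetric g₁ g₂ f₁ f₂ F).IsEinstein lam

/-- The tensorial system
`Ric' - (d/f) ∇'²f' = lam g'`, `∇~²f~ = 0`, `Ric~ = lam g~`, `Ric_F = 0`,
`f Δ'f' + (d-1) |∇f|² + lam f² = 0`. -/
structure TensorSystem (g₁ : PseudoRiemannianMetric I₁ B₁) (g₂ : PseudoRiemannianMetric I₂ B₂)
    (f₁ : PosFun I₁ B₁) (f₂ : PosFun I₂ B₂) (F : DerivedFiber d) (lam : ℝ) : Prop where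
  ricci_fst : ∀ x y, g₁.ricci x - ((d : ℝ) / f₁.sum f₂ (x, y)) • g₁.hessian f₁ x
    = lam • g₁.form x
  hessian_snd : ∀ y, g₂.hessian f₂ y = 0
  ricci_snd : ∀ y, g₂.ricci y = lam • g₂.form y
  ricci_fiber : ∀ z, F.metric.ricci z = 0
  warping : ∀ x y, f₁.sum f₂ (x, y) * g₁.laplacian f₁ x
    + ((d : ℝ) - 1) * (prodMetric g₁ g₂).gradSq (f₁.sum f₂) (x, y)
    + lam * f₁.sum f₂ (x, y) ^ 2 = 0

/-- The contracted system, with `k` (`= d` or `= n'`) in the place of the fiber dimension: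
`R' f - k Δ'f' = n' f lam`, `Δ~f~ = 0`, `R~ = lam n~`, `Ric_F = 0`,
`f Δ'f' + (k-1) |∇f|² + lam f² = 0`. -/
structure ScalarSystem (g₁ : PseudoRiemannianMetric I₁ B₁) (g₂ : PseudoRiemannianMetric I₂ B₂)
    (f₁ : PosFun I₁ B₁) (f₂ : PosFun I₂ B₂) (F : DerivedFiber d) (lam : ℝ) (k : ℕ) : Prop where
  scal_fst : ∀ x y, g₁.scal x * f₁.sum f₂ (x, y) - g₁.laplacian f₁ x * k
    = finrank ℝ E₁ * f₁.sum f₂ (x, y) * lam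
  laplacian_snd : ∀ y, g₂.laplacian f₂ y = 0
  scal_snd : ∀ y, g₂.scal y = lam * finrank ℝ E₂
  ricci_fiber : ∀ z, F.metric.ricci z = 0
  warping : ∀ x y, f₁.sum f₂ (x, y) * g₁.laplacian f₁ x
    + ((k : ℝ) - 1) * (prodMetric g₁ g₂).gradSq (f₁.sum f₂) (x, y)
    + lam * f₁.sum f₂ (x, y) ^ 2 = 0

/-- The Einstein condition `Ric = lam g` on `(B' × B~) ×_f F`, contracted over each of the three
factors `B'`, `B~`, `F`. -/
structure ContractedEinstein (g₁ : PseudoRiemannianMetric I₁ B₁)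
    (g₂ : PseudoRiemannianMetric I₂ B₂) (f₁ : PosFun I₁ B₁) (f₂ : PosFun I₂ B₂)
    (F : DerivedFiber d) (lam : ℝ) : Prop where
  fst : ∀ x y z, contractedRicci (J := I₁) (pndpMetric g₁ g₂ f₁ f₂ F)
    (fun x' => ((x', y), z)) x = lam * finrank ℝ E₁
  snd : ∀ x y z, contractedRicci (J := I₂) (pndpMetric g₁ g₂ f₁ f₂ F)
    (fun y' => ((x, y'), z)) y = lam * finrank ℝ E₂
  fiber : ∀ x y z, contractedRicci (J := 𝓡 d) (pndpMetric g₁ g₂ f₁ f₂ F)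
    (fun z' => ((x, y), z')) z = lam * d

/-- The trace over `B = B' × B~` of the base equation of the Einstein warped product system, and
its fiber equation multiplied by `d` (with `μ = 0`, the fiber being flat):
`R_B f² - f Δf d = n f² lam`, `f Δf d + d (d-1) |∇f|² + lam f² d = 0`. -/
structure WarpedScalarEquations (g₁ : PseudoRiemannianMetric I₁ B₁)
    (g₂ : PseudoRiemannianMetric I₂ B₂) (f₁ : PosFun I₁ B₁) (f₂ : PosFun I₂ B₂)
    (d : ℕ) (lam : ℝ) : Prop where
  base : ∀ p, (prodMetric g₁ g₂).scal p * f₁.sum f₂ p ^ 2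
    - f₁.sum f₂ p * (prodMetric g₁ g₂).laplacian (f₁.sum f₂) p * d
    = (finrank ℝ E₁ + finrank ℝ E₂) * f₁.sum f₂ p ^ 2 * lam
  fiber : ∀ p, f₁.sum f₂ p * (prodMetric g₁ g₂).laplacian (f₁.sum f₂) p * d
    + d * ((d : ℝ) - 1) * (prodMetric g₁ g₂).gradSq (f₁.sum f₂) p
    + lam * f₁.sum f₂ p ^ 2 * d = 0

end PNDP

end

/-! Everything rests on the Ricci tensor of a warped product $(M,g)\times_f(N,h)$ (`ricci_warped`).
It is block diagonal, with base block $Ric_g-\frac{\dim N}{f}\nabla^2f$ and fiber block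
$Ric_h-(f\Delta f+(\dim N-1)|\nabla f|^2)h$. This is proved in coordinates at the center of a
product chart: the Christoffel symbols are found by lowering an index, differentiated once, and
inserted into the curvature. Since Ricci is a trace, only the two diagonal blocks of $u\mapsto
R(u,v)w$ are needed (`riemann_inl_fst`, `riemann_inr_snd`).

The formula is used twice: with $f=1$ for the base $B'\times\widetilde B$, and with $f=f'+\widetilde
f$ for the flat fiber. The Hessian of $f'+\widetilde f$ is a direct sum, so $\overline{Ric}$ has
three blocks (`ricci_pndpMetric`), and $\overline{Ric}=\lambda\bar g$ amounts to one equation per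
factor. Given $\widetilde{Ric}=\lambda\widetilde g$, the middle equation reads $\frac
df\widetilde\nabla^2\widetilde f=0$. As $d>0$, this means $\widetilde\nabla^2\widetilde f=0$; then
$\widetilde\Delta\widetilde f=0$ and only $\Delta'f'$ survives in the fiber equation. This is (T).

For (b) the three blocks are traced separately and the same argument is run on scalars. Both cases
in the choice of $k$ give $k=d$, and $\bar R$ is the sum of the three traces. -/

noncomputable section

/-! ## Curvature of a warped product in coordinates -/

namespace Coord

open scoped Topology

/-! ### Connection, gradient and Hessian of one metric in coordinates. -/

section Metric

variable {E : Type*} [NormedAddCommGroup E] [NormedSpace ℝ E]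

/-- The field `G` is, near `x`, a twice continuously differentiable field of symmetric nondegenerate
bilinear forms. -/
structure IsMetricAt (G : E → E →L[ℝ] E →L[ℝ] ℝ) (x : E) : Prop where
  contDiffAt : ContDiffAt ℝ 2 G x
  symm : ∀ᶠ y in 𝓝 x, ∀ u v, G y u v = G y v u
  isInvertible : (G x).IsInvertible

/-- The gradient `∇φ`, obtained from `dφ` by raising the index with `G`. -/
def gradient (G : E → E →L[ℝ] E →L[ℝ] ℝ) (φ : E → ℝ) (x : E) : E :=
  (G x).inverse (fderiv ℝ φ x)

/-- The covariant derivative `u ↦ ∇ᵤ∇φ` of the gradient. -/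
def covGradient (G : E → E →L[ℝ] E →L[ℝ] ℝ) (φ : E → ℝ) (x : E) : E →L[ℝ] E :=
  fderiv ℝ (gradient G φ) x + (christoffel G x).flip (gradient G φ x)

lemma hessian_apply (G : E → E →L[ℝ] E →L[ℝ] ℝ) (φ : E → ℝ) (x u v : E) :
    hessian G φ x u v =
      fderiv ℝ (fderiv ℝ φ) x u v - fderiv ℝ φ x (christoffel G x u v) := rfl

lemma ricci_apply (G : E → E →L[ℝ] E →L[ℝ] ℝ) (x v w : E) :
    ricci G x v w = LinearMap.trace ℝ E (riemann G x v w).toLinearMap := rfl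

lemma fderiv_apply_apply {D F F' F'' : Type*} [NormedAddCommGroup D] [NormedSpace ℝ D]
    [NormedAddCommGroup F] [NormedSpace ℝ F] [NormedAddCommGroup F'] [NormedSpace ℝ F']
    [NormedAddCommGroup F''] [NormedSpace ℝ F'']
    {K : D → F →L[ℝ] F' →L[ℝ] F''} {z : D}
    (hK : DifferentiableAt ℝ K z) (U : D) (V : F) (W : F') :
    fderiv ℝ (fun z => K z V W) z U = fderiv ℝ K z U V W := by
  have h := (hK.hasFDerivAt.clm_apply (hasFDerivAt_const V z)).clm_apply (hasFDerivAt_const W z)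
  rw [h.fderiv]
  simp

lemma hasFDerivAt_apply_apply {D F F' F'' : Type*} [NormedAddCommGroup D] [NormedSpace ℝ D]
    [NormedAddCommGroup F] [NormedSpace ℝ F] [NormedAddCommGroup F'] [NormedSpace ℝ F']
    [NormedAddCommGroup F''] [NormedSpace ℝ F'']
    {K : D → F →L[ℝ] F' →L[ℝ] F''} {z : D}
    (hK : DifferentiableAt ℝ K z) (V : F) (W : F') :
    HasFDerivAt (fun z => K z V W) (((fderiv ℝ K z).flip V).flip W) z := by
  refine ((hK.hasFDerivAt.clm_apply (hasFDerivAt_const V z)).clm_apply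
    (hasFDerivAt_const W z)).congr_fderiv ?_
  ext U
  simp

variable {G : E → E →L[ℝ] E →L[ℝ] ℝ} {x : E} {φ : E → ℝ}

namespace IsMetricAt

lemma differentiableAt (hG : IsMetricAt G x) : DifferentiableAt ℝ G x :=
  hG.contDiffAt.differentiableAt (by simp)

lemma fderiv_symm (hG : IsMetricAt G x) (u v w : E) : fderiv ℝ G x u v w = fderiv ℝ G x u w v := by
  rw [← fderiv_apply_apply hG.differentiableAt, ← fderiv_apply_apply hG.differentiableAt]
  refine congrArg (fun L : E →L[ℝ] ℝ => L u) (Filter.EventuallyEq.fderiv_eq ?_)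
  filter_upwards [hG.symm] with y hy using hy v w

lemma form_symm (hG : IsMetricAt G x) (u v : E) : G x u v = G x v u := hG.symm.self_of_nhds u v

lemma apply_christoffel (hG : IsMetricAt G x) (u v w : E) :
    G x (christoffel G x u v) w =
      1 / 2 * (fderiv ℝ G x u v w + fderiv ℝ G x v u w - fderiv ℝ G x w u v) := by
  rw [christoffel_apply, hG.isInvertible.self_apply_inverse, christoffelFst_apply]

lemma christoffel_symm (hG : IsMetricAt G x) (u v : E) :
    christoffel G x u v = christoffel G x v u := by
  apply hG.isInvertible.injective
  ext w
  rw [hG.apply_christoffel, hG.apply_christoffel, hG.fderiv_symm w u v]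
  ring

lemma apply_gradient (hG : IsMetricAt G x) (φ : E → ℝ) (u : E) :
    G x (gradient G φ x) u = fderiv ℝ φ x u := by
  rw [gradient, hG.isInvertible.self_apply_inverse]

lemma differentiableAt_fderiv (hG : IsMetricAt G x) : DifferentiableAt ℝ (fderiv ℝ G) x :=
  (hG.contDiffAt.fderiv_right (m := 1) (by norm_num)).differentiableAt (by simp)

variable [CompleteSpace E]

/-- Invertible operators form an open set, so the pointwise condition at `x` spreads to a
neighborhood. Identities valid at every metric point may therefore be differentiated. -/
lemma eventually (hG : IsMetricAt G x) : ∀ᶠ y in 𝓝 x, IsMetricAt G y := by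
  have hi : ∀ᶠ y in 𝓝 x, (G y).IsInvertible := by
    obtain ⟨e, he⟩ := hG.isInvertible
    exact hG.differentiableAt.continuousAt (by rw [← he]; exact e.nhds)
  filter_upwards [hG.contDiffAt.eventually (by simp), hG.symm.eventually_nhds, hi]
    with y h₁ h₂ h₃ using ⟨h₁, h₂, h₃⟩

lemma differentiableAt_inverse (hG : IsMetricAt G x) :
    DifferentiableAt ℝ (fun y => (G y).inverse) x :=
  DifferentiableAt.comp x
    ((hG.isInvertible.contDiffAt_map_inverse (n := 1)).differentiableAt (by simp))
    hG.differentiableAt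

lemma differentiableAt_christoffel (hG : IsMetricAt G x) :
    DifferentiableAt ℝ (christoffel G) x := by
  have h := hG.differentiableAt_fderiv
  have hflip : DifferentiableAt ℝ (fun y => (fderiv ℝ G y).flip) x :=
    (ContinuousLinearMap.flipₗᵢ ℝ E E
      (E →L[ℝ] ℝ)).toContinuousLinearEquiv.differentiableAt.comp x h
  have h₁ : DifferentiableAt ℝ (christoffelFst G) x :=
    ((h.add hflip).sub ((differentiableAt_const (flipCLM E)).clm_comp hflip)).const_smul (1 / 2 : ℝ)
  exact DifferentiableAt.clm_comp
    ((ContinuousLinearMap.compL ℝ E (E →L[ℝ] ℝ) E).differentiableAt.comp x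
      hG.differentiableAt_inverse) h₁

lemma differentiableAt_gradient (hG : IsMetricAt G x) (hφ : ContDiffAt ℝ 2 φ x) :
    DifferentiableAt ℝ (gradient G φ) x :=
  hG.differentiableAt_inverse.clm_apply
    ((hφ.fderiv_right (m := 1) (by norm_num)).differentiableAt (by simp))

/-- The Hessian is `⟨∇ᵤ∇φ, v⟩`. -/
lemma apply_covGradient (hG : IsMetricAt G x) (hφ : ContDiffAt ℝ 2 φ x) (u v : E) :
    G x (covGradient G φ x u) v = hessian G φ x u v := by
  have hd : DifferentiableAt ℝ (fderiv ℝ φ) x :=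
    (hφ.fderiv_right (m := 1) (by norm_num)).differentiableAt (by simp)
  have hN := hG.differentiableAt_gradient hφ
  have h₁ := (hG.differentiableAt.hasFDerivAt.clm_apply hN.hasFDerivAt).clm_apply
    (hasFDerivAt_const v x)
  have h₂ := hd.hasFDerivAt.clm_apply (hasFDerivAt_const v x)
  -- The defining identity $G(\nabla\varphi,v)=d\varphi(v)$ holds near `x`. Its derivative along `u`
  -- produces $\partial_u G$, which the Christoffel terms absorb.
  have he : (fun y => G y (gradient G φ y) v) =ᶠ[𝓝 x] fun y => fderiv ℝ φ y v := by
    filter_upwards [hG.eventually] with y hy using hy.apply_gradient φ v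
  have key := congrArg (fun L : E →L[ℝ] ℝ => L u) ((h₂.congr_of_eventuallyEq he).unique h₁)
  simp at key
  have e₁ := hG.apply_christoffel u (gradient G φ x) v
  have e₂ := hG.apply_christoffel u v (gradient G φ x)
  rw [hG.form_symm, hG.apply_gradient] at e₂
  rw [hessian_apply, e₂, key, covGradient]
  simp only [add_apply, ContinuousLinearMap.flip_apply, map_add, e₁]
  rw [hG.fderiv_symm u v, hG.fderiv_symm v u]
  ring

end IsMetricAt

end Metric

/-! ### Connection and curvature of $G+\varphi^2H$. -/

section Warped

variable {E : Type*} [NormedAddCommGroup E] [NormedSpace ℝ E]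
  {E' : Type*} [NormedAddCommGroup E'] [NormedSpace ℝ E']
  {G : E → E →L[ℝ] E →L[ℝ] ℝ} {H : E' → E' →L[ℝ] E' →L[ℝ] ℝ} {φ : E → ℝ}
  {K : E × E' → E × E' →L[ℝ] E × E' →L[ℝ] ℝ} {x : E} {y : E'} {z : E × E'}

/-- Near `z`, the metric `K` is the warped product `G + φ² H`. -/
structure IsWarpedAt (G : E → E →L[ℝ] E →L[ℝ] ℝ) (φ : E → ℝ) (H : E' → E' →L[ℝ] E' →L[ℝ] ℝ)
    (K : E × E' → E × E' →L[ℝ] E × E' →L[ℝ] ℝ) (z : E × E') : Prop where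
  base : IsMetricAt G z.1
  fiber : IsMetricAt H z.2
  total : IsMetricAt K z
  contDiffAt : ContDiffAt ℝ 2 φ z.1
  ne_zero : φ z.1 ≠ 0
  eventually_eq : ∀ᶠ w in 𝓝 z, ∀ U V, K w U V = G w.1 U.1 V.1 + φ w.1 ^ 2 * H w.2 U.2 V.2

lemma _root_.HasFDerivAt.comp_prodFst {F : Type*} [NormedAddCommGroup F] [NormedSpace ℝ F]
    {f : E → F} {f' : E →L[ℝ] F} {z : E × E'} (h : HasFDerivAt f f' z.1) :
    HasFDerivAt (fun w : E × E' => f w.1) (f'.comp (ContinuousLinearMap.fst ℝ E E')) z :=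
  HasFDerivAt.comp z h hasFDerivAt_fst

lemma _root_.HasFDerivAt.comp_prodSnd {F : Type*} [NormedAddCommGroup F] [NormedSpace ℝ F]
    {f : E' → F} {f' : E' →L[ℝ] F} {z : E × E'} (h : HasFDerivAt f f' z.2) :
    HasFDerivAt (fun w : E × E' => f w.2) (f'.comp (ContinuousLinearMap.snd ℝ E E')) z :=
  HasFDerivAt.comp z h hasFDerivAt_snd

namespace IsWarpedAt

lemma differentiableAt (h : IsWarpedAt G φ H K z) : DifferentiableAt ℝ φ z.1 :=
  h.contDiffAt.differentiableAt (by simp)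

lemma differentiableAt_fderiv (h : IsWarpedAt G φ H K z) : DifferentiableAt ℝ (fderiv ℝ φ) z.1 :=
  (h.contDiffAt.fderiv_right (m := 1) (by norm_num)).differentiableAt (by simp)

lemma apply (h : IsWarpedAt G φ H K z) (U V : E × E') :
    K z U V = G z.1 U.1 V.1 + φ z.1 ^ 2 * H z.2 U.2 V.2 := h.eventually_eq.self_of_nhds U V

lemma fderiv_apply (h : IsWarpedAt G φ H K z) (U V W : E × E') :
    fderiv ℝ K z U V W = fderiv ℝ G z.1 U.1 V.1 W.1
      + 2 * φ z.1 * fderiv ℝ φ z.1 U.1 * H z.2 V.2 W.2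
      + φ z.1 ^ 2 * fderiv ℝ H z.2 U.2 V.2 W.2 := by
  rw [← fderiv_apply_apply h.total.differentiableAt]
  have h₁ := (hasFDerivAt_apply_apply h.base.differentiableAt V.1 W.1).comp_prodFst (z := z)
  have h₂ := (hasFDerivAt_apply_apply h.fiber.differentiableAt V.2 W.2).comp_prodSnd (z := z)
  have h₃ := (h.differentiableAt.hasFDerivAt.comp_prodFst (z := z)).pow 2
  have h₄ := (h₁.add (h₃.mul h₂)).congr_of_eventuallyEq
    (f₁ := fun w => K w V W) (by filter_upwards [h.eventually_eq] with w hw using hw V W)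
  rw [h₄.fderiv]
  simp
  ring

/-- As `K` is nondegenerate, it suffices to compare after lowering the index. The only mixed term in
$\partial K$ is $2\varphi\,d\varphi\,H$. Raised along the fiber it is divided by $\varphi^2$ and
gives the factors $\varphi^{-1}d\varphi$; raised along the base it gives $-\varphi H\nabla\varphi$.
-/
lemma christoffel_apply (h : IsWarpedAt G φ H K z) (U V : E × E') :
    christoffel K z U V =
      (christoffel G z.1 U.1 V.1 - (φ z.1 * H z.2 U.2 V.2) • gradient G φ z.1,
       christoffel H z.2 U.2 V.2 + ((φ z.1)⁻¹ * fderiv ℝ φ z.1 U.1) • V.2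
         + ((φ z.1)⁻¹ * fderiv ℝ φ z.1 V.1) • U.2) := by
  apply h.total.isInvertible.injective
  refine ContinuousLinearMap.ext fun W => ?_
  have hne := h.ne_zero
  rw [h.total.apply_christoffel, h.apply]
  simp only [h.fderiv_apply, map_sub, map_add, map_smul, sub_apply, add_apply, smul_apply,
    h.base.apply_christoffel, h.fiber.apply_christoffel, h.base.apply_gradient, smul_eq_mul]
  rw [h.fiber.form_symm U.2 W.2, h.fiber.form_symm V.2 W.2, h.fiber.form_symm W.2 U.2,
    h.fiber.form_symm W.2 V.2]
  field_simp
  ring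

variable [CompleteSpace E] [CompleteSpace E']

lemma eventually (h : IsWarpedAt G φ H K z) : ∀ᶠ w in 𝓝 z, IsWarpedAt G φ H K w := by
  have t₁ : Filter.Tendsto (Prod.fst : E × E' → E) (𝓝 z) (𝓝 z.1) := continuous_fst.continuousAt
  have t₂ : Filter.Tendsto (Prod.snd : E × E' → E') (𝓝 z) (𝓝 z.2) := continuous_snd.continuousAt
  filter_upwards [t₁.eventually h.base.eventually, t₂.eventually h.fiber.eventually,
    h.total.eventually, t₁.eventually (h.contDiffAt.eventually (by simp)),
    t₁.eventually (h.differentiableAt.continuousAt.eventually_ne h.ne_zero),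
    h.eventually_eq.eventually_nhds] with w h₁ h₂ h₃ h₄ h₅ h₆
  exact ⟨h₁, h₂, h₃, h₄, h₅, h₆⟩

/-- The explicit Christoffel formula holds on a whole neighborhood of `z`, so differentiating it
gives the derivative of the true symbols. -/
lemma fderiv_christoffel_fst (h : IsWarpedAt G φ H K z) (U V W : E × E') :
    (fderiv ℝ (christoffel K) z U V W).1 = fderiv ℝ (christoffel G) z.1 U.1 V.1 W.1
      - (φ z.1 * H z.2 V.2 W.2) • fderiv ℝ (gradient G φ) z.1 U.1
      - (φ z.1 * fderiv ℝ H z.2 U.2 V.2 W.2 + fderiv ℝ φ z.1 U.1 * H z.2 V.2 W.2) •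
        gradient G φ z.1 := by
  have hK := (hasFDerivAt_apply_apply h.total.differentiableAt_christoffel V W).fst
  have h₁ := (hasFDerivAt_apply_apply h.base.differentiableAt_christoffel V.1 W.1).comp_prodFst
    (z := z)
  have h₂ := (hasFDerivAt_apply_apply h.fiber.differentiableAt V.2 W.2).comp_prodSnd (z := z)
  have h₃ := h.differentiableAt.hasFDerivAt.comp_prodFst (z := z)
  have h₄ := (h.base.differentiableAt_gradient h.contDiffAt).hasFDerivAt.comp_prodFst (z := z)
  have he := (h₁.sub ((h₃.mul h₂).smul h₄)).congr_of_eventuallyEq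
    (f₁ := fun w => (christoffel K w V W).1)
    (by filter_upwards [h.eventually] with w hw; simp [hw.christoffel_apply])
  have := congrArg (fun L : E × E' →L[ℝ] E => L U) (hK.unique he)
  simp at this
  rw [this, sub_sub, mul_comm (fderiv ℝ φ z.1 U.1)]

lemma fderiv_christoffel_snd (h : IsWarpedAt G φ H K z) (U V W : E × E') :
    (fderiv ℝ (christoffel K) z U V W).2 = fderiv ℝ (christoffel H) z.2 U.2 V.2 W.2
      + ((φ z.1)⁻¹ * fderiv ℝ (fderiv ℝ φ) z.1 U.1 V.1
          - fderiv ℝ φ z.1 U.1 * fderiv ℝ φ z.1 V.1 / φ z.1 ^ 2) • W.2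
      + ((φ z.1)⁻¹ * fderiv ℝ (fderiv ℝ φ) z.1 U.1 W.1
          - fderiv ℝ φ z.1 U.1 * fderiv ℝ φ z.1 W.1 / φ z.1 ^ 2) • V.2 := by
  have hK := (hasFDerivAt_apply_apply h.total.differentiableAt_christoffel V W).snd
  have h₁ := (hasFDerivAt_apply_apply h.fiber.differentiableAt_christoffel V.2 W.2).comp_prodSnd
    (z := z)
  have h₃ := ((hasDerivAt_inv h.ne_zero).comp_hasFDerivAt z.1
    h.differentiableAt.hasFDerivAt).comp_prodFst (z := z)
  have h₄ : ∀ v : E, HasFDerivAt (fun w : E × E' => fderiv ℝ φ w.1 v) _ z := fun v =>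
    (h.differentiableAt_fderiv.hasFDerivAt.clm_apply (hasFDerivAt_const v z.1)).comp_prodFst
  have he := ((h₁.add ((h₃.mul (h₄ V.1)).smul_const W.2)).add
      ((h₃.mul (h₄ W.1)).smul_const V.2)).congr_of_eventuallyEq
    (f₁ := fun w => (christoffel K w V W).2)
    (by filter_upwards [h.eventually] with w hw; simp [hw.christoffel_apply])
  have := congrArg (fun L : E × E' →L[ℝ] E' => L U) (hK.unique he)
  simp at this
  rw [this]
  congr 3 <;> ring

/-- Diagonal block on horizontal `u`. The terms $d\varphi(u)H(V,W)\nabla\varphi$ from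
$\partial\Gamma$ and from $\Gamma\Gamma$ cancel; what remains beside the curvature of `G` assembles
into $\nabla_u\nabla\varphi$. -/
lemma riemann_inl_fst (h : IsWarpedAt G φ H K z) (V W : E × E') (u : E) :
    (riemann K z V W (u, 0)).1 = riemann G z.1 V.1 W.1 u
      - (φ z.1 * H z.2 V.2 W.2) • covGradient G φ z.1 u := by
  have hne := h.ne_zero
  rw [riemann_apply, riemann_apply]
  simp only [Prod.fst_add, Prod.fst_sub, h.fderiv_christoffel_fst, h.christoffel_apply,
    covGradient, map_zero, map_add, map_sub, map_smul, add_apply,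
    zero_apply, smul_zero, smul_eq_mul, ContinuousLinearMap.flip_apply]
  simp only [mul_zero, zero_add, add_zero, zero_smul, sub_zero]
  match_scalars <;> field_simp
  ring

lemma riemann_inr_snd (h : IsWarpedAt G φ H K z) (V W : E × E') (u : E') :
    (riemann K z V W (0, u)).2 = riemann H z.2 V.2 W.2 u
      - ((φ z.1)⁻¹ * hessian G φ z.1 V.1 W.1) • u
      - fderiv ℝ φ z.1 (gradient G φ z.1) • (H z.2 V.2 W.2 • u - H z.2 u W.2 • V.2) := by
  have hne := h.ne_zero
  rw [riemann_apply, riemann_apply, hessian_apply]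
  simp only [Prod.snd_add, Prod.snd_sub, h.fderiv_christoffel_snd, h.christoffel_apply,
    map_zero, map_add, map_sub, map_smul,
    zero_apply, smul_zero, smul_eq_mul]
  -- The two products containing $\varphi^{-1}d\varphi(W)$ and a fiber Christoffel symbol cancel
  -- only by torsion-freeness.
  rw [h.fiber.christoffel_symm u V.2]
  simp only [mul_zero, add_zero, zero_smul, sub_zero, smul_sub, zero_mul, zero_div, smul_add]
  match_scalars <;> field_simp <;> ring

end IsWarpedAt

end Warped

end Coord

/-! ## Traces of bilinear forms -/

section Trace

open LinearMap

variable {V W : Type*} [AddCommGroup V] [Module ℝ V] [AddCommGroup W] [Module ℝ W]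
  [FiniteDimensional ℝ V] [FiniteDimensional ℝ W]

/-- Split `A` as the sum of its parts with values in each factor and apply cyclicity of the trace to
each; off-diagonal blocks never enter. -/
lemma LinearMap.trace_prod_eq (A : V × W →ₗ[ℝ] V × W) :
    trace ℝ (V × W) A = trace ℝ V (fst ℝ V W ∘ₗ A ∘ₗ inl ℝ V W)
      + trace ℝ W (snd ℝ V W ∘ₗ A ∘ₗ inr ℝ V W) := by
  have h : A = inl ℝ V W ∘ₗ (fst ℝ V W ∘ₗ A) + inr ℝ V W ∘ₗ (snd ℝ V W ∘ₗ A) := by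
    ext v <;> simp
  conv_lhs => rw [h]
  rw [map_add, trace_comp_comm', trace_comp_comm' _ (inr ℝ V W)]
  rfl

variable {g b : LinearMap.BilinForm ℝ V}

/-- The endomorphism raising an index of `b` is unique, so any explicit candidate computes the
trace. -/
lemma metricTrace_eq_trace (hg : g.Nondegenerate) {A : V →ₗ[ℝ] V}
    (h : ∀ u v, g (A u) v = b u v) : metricTrace g b = trace ℝ V A := by
  rw [metricTrace, dif_pos hg]
  congr 1
  ext u
  rw [LinearMap.comp_apply, LinearEquiv.coe_coe, LinearEquiv.symm_apply_eq]
  ext v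
  exact (h u v).symm

/-- Linearity needs no nondegeneracy: for degenerate `g` all terms take the default value `0`. -/
lemma metricTrace_add (g b c : LinearMap.BilinForm ℝ V) :
    metricTrace g (b + c) = metricTrace g b + metricTrace g c := by
  unfold metricTrace
  split_ifs
  · rw [LinearMap.comp_add, map_add]
  · simp

lemma metricTrace_smul (g : LinearMap.BilinForm ℝ V) (r : ℝ) (b : LinearMap.BilinForm ℝ V) :
    metricTrace g (r • b) = r * metricTrace g b := by
  unfold metricTrace
  split_ifs
  · rw [LinearMap.comp_smul, map_smul, smul_eq_mul]
  · simp

lemma metricTrace_sub (g b c : LinearMap.BilinForm ℝ V) :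
    metricTrace g (b - c) = metricTrace g b - metricTrace g c := by
  rw [sub_eq_add_neg, metricTrace_add, ← neg_one_smul ℝ c, metricTrace_smul]
  ring

lemma metricTrace_zero (g : LinearMap.BilinForm ℝ V) : metricTrace g 0 = 0 := by
  simpa using metricTrace_smul g 0 0

lemma metricTrace_self (hg : g.Nondegenerate) : metricTrace g g = finrank ℝ V := by
  rw [metricTrace_eq_trace hg (A := LinearMap.id) fun _ _ => rfl, trace_id]

lemma exists_raise (hg : g.Nondegenerate) (b : LinearMap.BilinForm ℝ V) :
    ∃ A : V →ₗ[ℝ] V, ∀ u v, g (A u) v = b u v :=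
  ⟨(LinearMap.BilinForm.toDual g hg).symm.toLinearMap ∘ₗ b, fun u v => by
    rw [LinearMap.comp_apply, LinearEquiv.coe_coe,
      LinearMap.BilinForm.apply_toDual_symm_apply]⟩

/-- Source of the factor $f^{-2}$ when tracing over the fiber, whose metric is scaled by $f^2$. -/
lemma metricTrace_smul_left (hg : g.Nondegenerate) {r : ℝ} (hr : r ≠ 0)
    (b : LinearMap.BilinForm ℝ V) : metricTrace (r • g) b = r⁻¹ * metricTrace g b := by
  obtain ⟨A, hA⟩ := exists_raise hg b
  have hr' : (r • g).Nondegenerate :=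
    ⟨fun v hv => hg.1 v fun w => by simpa [hr] using hv w,
      fun v hv => hg.2 v fun w => by simpa [hr] using hv w⟩
  rw [metricTrace_eq_trace hg hA, metricTrace_eq_trace hr' (A := r⁻¹ • A) fun u v => ?_,
    map_smul, smul_eq_mul]
  simp [hA, hr]

/-- The trace of a block diagonal form with respect to a block diagonal form. -/
lemma metricTrace_prod {h e : LinearMap.BilinForm ℝ W} (hg : g.Nondegenerate)
    (hh : h.Nondegenerate) (b : LinearMap.BilinForm ℝ V) :
    metricTrace (pullForm g (fst ℝ V W) + pullForm h (snd ℝ V W))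
      (pullForm b (fst ℝ V W) + pullForm e (snd ℝ V W)) = metricTrace g b + metricTrace h e := by
  obtain ⟨A, hA⟩ := exists_raise hg b
  obtain ⟨C, hC⟩ := exists_raise hh e
  have hn : (pullForm g (fst ℝ V W) + pullForm h (snd ℝ V W)).Nondegenerate := by
    constructor
    · intro v hv
      exact Prod.ext (hg.1 _ fun w => by simpa using hv (w, 0))
        (hh.1 _ fun w => by simpa using hv (0, w))
    · intro v hv
      exact Prod.ext (hg.2 _ fun w => by simpa using hv (w, 0))
        (hh.2 _ fun w => by simpa using hv (0, w))
  rw [metricTrace_eq_trace hg hA, metricTrace_eq_trace hh hC,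
    metricTrace_eq_trace hn (A := A.prodMap C) fun u v => by simp [hA, hC], trace_prodMap']

end Trace

/-! ### Traces of the coordinate formulas. -/

namespace Coord

open scoped Topology

variable {E : Type*} [NormedAddCommGroup E] [NormedSpace ℝ E]
  {G : E → E →L[ℝ] E →L[ℝ] ℝ} {φ : E → ℝ} {x : E}

/-- A constant metric is flat. -/
lemma ricci_eq_zero_of_eventually_const (hG : ∀ᶠ y in 𝓝 x, G y = G x) :
    ricci G x = 0 := by
  -- Vanishing near `x`, not merely at `x`, is needed because the curvature differentiates the
  -- symbols.
  have h₁ : ∀ᶠ y in 𝓝 x, christoffel G y = 0 := by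
    filter_upwards [hG.eventually_nhds] with y hy
    have h₀ : fderiv ℝ G y = 0 := by
      rw [Filter.EventuallyEq.fderiv_eq (f := fun _ => G x) hy]
      simp
    ext u v
    rw [Coord.christoffel_apply]
    have : christoffelFst G y u v = 0 := by
      ext w
      rw [christoffelFst_apply, h₀]
      simp
    rw [this]
    simp
  have h₂ : fderiv ℝ (christoffel G) x = 0 := by
    rw [Filter.EventuallyEq.fderiv_eq (f := fun _ => 0) h₁]
    simp
  ext v w
  rw [Coord.ricci_apply]
  have : riemann G x v w = 0 := by
    ext u
    rw [riemann_apply, h₂, h₁.self_of_nhds]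
    simp
  rw [this]
  simp

/-- `g` and `G x` are one form in two types, algebraic and continuous; raising an index of the
Hessian gives $u\mapsto\nabla_u\nabla\varphi$. -/
lemma metricTrace_hessian [FiniteDimensional ℝ E] (hG : IsMetricAt G x) (hφ : ContDiffAt ℝ 2 φ x)
    {g : LinearMap.BilinForm ℝ E} (hg : g.Nondegenerate) (hgG : ∀ u v, g u v = G x u v) :
    metricTrace g (hessian G φ x)
      = LinearMap.trace ℝ E (covGradient G φ x).toLinearMap := by
  have := FiniteDimensional.complete ℝ E
  refine metricTrace_eq_trace hg fun u v => ?_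
  rw [hgG]
  exact hG.apply_covGradient hφ u v

variable {E' : Type*} [NormedAddCommGroup E'] [NormedSpace ℝ E']
  {H : E' → E' →L[ℝ] E' →L[ℝ] ℝ} {K : E × E' → E × E' →L[ℝ] E × E' →L[ℝ] ℝ} {z : E × E'}

/-- The Hessian of `(x, y) ↦ α x + β y` on a direct product. -/
lemma IsWarpedAt.hessian_add (h : IsWarpedAt G φ H K z) (hφ : ∀ᶠ x in 𝓝 z.1, φ x = 1)
    {α : E → ℝ} {β : E' → ℝ} (hα : ContDiffAt ℝ 2 α z.1) (hβ : ContDiffAt ℝ 2 β z.2)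
    (U V : E × E') :
    hessian K (fun w => α w.1 + β w.2) z U V
      = hessian G α z.1 U.1 V.1 + hessian H β z.2 U.2 V.2 := by
  have hφ' : fderiv ℝ φ z.1 = 0 := by
    rw [Filter.EventuallyEq.fderiv_eq (f := fun _ => (1 : ℝ)) hφ]
    simp
  have hd : ∀ᶠ w in 𝓝 z, HasFDerivAt (fun w : E × E' => α w.1 + β w.2)
      ((fderiv ℝ α w.1).comp (ContinuousLinearMap.fst ℝ E E')
        + (fderiv ℝ β w.2).comp (ContinuousLinearMap.snd ℝ E E')) w := by
    have t₁ : Filter.Tendsto (Prod.fst : E × E' → E) (𝓝 z) (𝓝 z.1) := continuous_fst.continuousAt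
    have t₂ : Filter.Tendsto (Prod.snd : E × E' → E') (𝓝 z) (𝓝 z.2) :=
      continuous_snd.continuousAt
    filter_upwards [t₁.eventually (hα.eventually (by simp)),
      t₂.eventually (hβ.eventually (by simp))] with w h₁ h₂
    exact (h₁.differentiableAt (by simp)).hasFDerivAt.comp_prodFst.add
      (h₂.differentiableAt (by simp)).hasFDerivAt.comp_prodSnd
  have hα' : DifferentiableAt ℝ (fderiv ℝ α) z.1 :=
    (hα.fderiv_right (m := 1) (by norm_num)).differentiableAt (by simp)
  have hβ' : DifferentiableAt ℝ (fderiv ℝ β) z.2 :=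
    (hβ.fderiv_right (m := 1) (by norm_num)).differentiableAt (by simp)
  have hd₂ := ((hα'.hasFDerivAt.comp_prodFst (z := z)).clm_comp
      (hasFDerivAt_const (ContinuousLinearMap.fst ℝ E E') z)).add
    ((hβ'.hasFDerivAt.comp_prodSnd (z := z)).clm_comp
      (hasFDerivAt_const (ContinuousLinearMap.snd ℝ E E') z))
  have hd₃ := hd₂.congr_of_eventuallyEq
    (f₁ := fderiv ℝ fun w : E × E' => α w.1 + β w.2)
    (by filter_upwards [hd] with w hw; simp [hw.fderiv])
  rw [hessian_apply, hessian_apply, hessian_apply, hd₃.fderiv, hd.self_of_nhds.fderiv,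
    h.christoffel_apply]
  simp [hφ', gradient]
  ring

/-- The Ricci tensor of a warped product. -/
lemma IsWarpedAt.ricci_apply [FiniteDimensional ℝ E] [FiniteDimensional ℝ E']
    (h : IsWarpedAt G φ H K z) (V W : E × E') :
    ricci K z V W = ricci G z.1 V.1 W.1 - finrank ℝ E' / φ z.1 * hessian G φ z.1 V.1 W.1
      + (ricci H z.2 V.2 W.2 - (φ z.1 * LinearMap.trace ℝ E (covGradient G φ z.1).toLinearMap
        + (finrank ℝ E' - 1) * fderiv ℝ φ z.1 (gradient G φ z.1)) * H z.2 V.2 W.2) := by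
  have := FiniteDimensional.complete ℝ E
  have := FiniteDimensional.complete ℝ E'
  rw [Coord.ricci_apply, LinearMap.trace_prod_eq]
  have h₁ : LinearMap.fst ℝ E E' ∘ₗ (riemann K z V W).toLinearMap ∘ₗ LinearMap.inl ℝ E E'
      = (riemann G z.1 V.1 W.1).toLinearMap
        - (φ z.1 * H z.2 V.2 W.2) • (covGradient G φ z.1).toLinearMap :=
    LinearMap.ext fun u => h.riemann_inl_fst V W u
  -- The rank-one term $u\mapsto H(u,W)V$ has trace $H(V,W)$, which lowers the coefficient $\dim E'$
  -- of $|\nabla\varphi|^2$ by one.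
  have h₂ : LinearMap.snd ℝ E E' ∘ₗ (riemann K z V W).toLinearMap ∘ₗ LinearMap.inr ℝ E E'
      = (riemann H z.2 V.2 W.2).toLinearMap
        - ((φ z.1)⁻¹ * hessian G φ z.1 V.1 W.1) • LinearMap.id
        - fderiv ℝ φ z.1 (gradient G φ z.1) • (H z.2 V.2 W.2 • LinearMap.id
          - ((H z.2).flip W.2).toLinearMap.smulRight V.2) :=
    LinearMap.ext fun u => h.riemann_inr_snd V W u
  rw [h₁, h₂]
  simp only [map_sub, map_smul, LinearMap.trace_id, LinearMap.trace_smulRight, smul_eq_mul,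
    ContinuousLinearMap.coe_coe, ContinuousLinearMap.flip_apply, ← Coord.ricci_apply]
  ring

end Coord

/-! ## Riemannian operations at the center of a chart -/

open scoped Topology

namespace PseudoRiemannianMetric

variable {E : Type*} [NormedAddCommGroup E] [NormedSpace ℝ E] [FiniteDimensional ℝ E]
  {H : Type*} [TopologicalSpace H] {I : ModelWithCorners ℝ E H} [I.Boundaryless]
  {M : Type*} [TopologicalSpace M] [ChartedSpace H M] [IsManifold I ∞ M]
  (g : PseudoRiemannianMetric I M) {f : M → ℝ} (p : M)

-- The tangent space at `p` is by construction the model space seen through the chart at `p`. Hence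
-- forms at `p` and their components at the chart center coincide.
omit [FiniteDimensional ℝ E] in
lemma mfderiv_extChartAt_symm_self :
    mfderiv 𝓘(ℝ, E) I (extChartAt I p).symm (extChartAt I p p) = ContinuousLinearMap.id ℝ E := by
  have h := mfderivWithin_range_extChartAt_symm (I := I) (x := p)
  rw [I.range_eq_univ, mfderivWithin_univ] at h
  exact h

omit [IsManifold I ∞ M] [I.Boundaryless] in
lemma inChart_apply (b : ∀ x : M, LinearMap.BilinForm ℝ (TangentSpace I x)) (x u v : E) :
    inChart I b p x u v = b ((extChartAt I p).symm x)
      (mfderiv 𝓘(ℝ, E) I (extChartAt I p).symm x u)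
      (mfderiv 𝓘(ℝ, E) I (extChartAt I p).symm x v) := rfl

lemma inChart_self (u v : E) :
    inChart I g.form p (extChartAt I p p) u v = g.form p u v := by
  rw [inChart_apply, mfderiv_extChartAt_symm_self]
  -- The base point is $\varphi^{-1}(\varphi(p))$, equal to `p` only propositionally; generalizing
  -- it avoids a dependent rewrite.
  have h : ∀ q : M, q = p → (g.form q : LinearMap.BilinForm ℝ E) u v = g.form p u v := by
    rintro q rfl
    rfl
  exact h _ (extChartAt_to_inv p)

lemma isInvertible_inChart_self : (inChart I g.form p (extChartAt I p p)).IsInvertible := by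
  have hinj : Function.Injective (inChart I g.form p (extChartAt I p p)).toLinearMap := by
    rw [injective_iff_map_eq_zero]
    intro u hu
    refine (g.nondegenerate p).1 u fun v => ?_
    exact (g.inChart_self p u v).symm.trans (congrArg (fun L : E →L[ℝ] ℝ => L v) hu)
  have hdim : finrank ℝ E = finrank ℝ (E →L[ℝ] ℝ) := by
    rw [← LinearMap.toContinuousLinearMap.finrank_eq]
    exact Subspace.dual_finrank_eq.symm
  exact ⟨(LinearEquiv.ofInjectiveOfFinrankEq _ hinj hdim).toContinuousLinearEquiv, rfl⟩

lemma isMetricAt_inChart : Coord.IsMetricAt (inChart I g.form p) (extChartAt I p p) where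
  contDiffAt := by
    have h : ContDiffOn ℝ ∞ (inChart I g.form p) (extChartAt I p).target :=
      contDiffOn_clm_apply.2 fun u => contDiffOn_clm_apply.2 fun v => g.smooth p u v
    exact (h.contDiffAt (extChartAt_target_mem_nhds p)).of_le (by norm_cast)
  symm := Filter.Eventually.of_forall fun x u v => g.symm _ _ _
  isInvertible := g.isInvertible_inChart_self p

omit [I.Boundaryless] in
lemma ricci_apply (v w : E) :
    g.ricci p v w = Coord.ricci (inChart I g.form p) (extChartAt I p p) v w := by
  unfold ricci
  rw [mfderiv_extChartAt_self]
  rfl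

omit [I.Boundaryless] in
lemma hessian_apply (f : M → ℝ) (v w : E) :
    g.hessian f p v w = Coord.hessian (inChart I g.form p) (f ∘ (extChartAt I p).symm)
      (extChartAt I p p) v w := by
  unfold hessian
  rw [mfderiv_extChartAt_self]
  rfl

variable {p}

omit [FiniteDimensional ℝ E] in
lemma contDiffAt_comp_extChartAt_symm (hf : ContMDiff I 𝓘(ℝ, ℝ) ∞ f) :
    ContDiffAt ℝ 2 (f ∘ (extChartAt I p).symm) (extChartAt I p p) := by
  have h : ContDiffOn ℝ ∞ (f ∘ (extChartAt I p).symm) (extChartAt I p).target :=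
    contMDiffOn_iff_contDiffOn.1 (hf.comp_contMDiffOn (contMDiffOn_extChartAt_symm p))
  exact (h.contDiffAt (extChartAt_target_mem_nhds p)).of_le (by norm_cast)

lemma laplacian_eq (hf : ContMDiff I 𝓘(ℝ, ℝ) ∞ f) :
    g.laplacian f p = LinearMap.trace ℝ E
      (Coord.covGradient (inChart I g.form p) (f ∘ (extChartAt I p).symm)
        (extChartAt I p p)).toLinearMap := by
  rw [← Coord.metricTrace_hessian (g := (g.form p : LinearMap.BilinForm ℝ E))
    (g.isMetricAt_inChart p) (contDiffAt_comp_extChartAt_symm hf) (g.nondegenerate p)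
    fun u v => (g.inChart_self p u v).symm]
  have h : g.hessian f p = (Coord.hessian (inChart I g.form p) (f ∘ (extChartAt I p).symm)
      (extChartAt I p p) : LinearMap.BilinForm ℝ E) :=
    LinearMap.ext₂ fun v w => g.hessian_apply p f v w
  rw [laplacian, h]
  rfl

omit [FiniteDimensional ℝ E] [IsManifold I ∞ M] in
lemma mfderiv_eq_fderiv_chart (hf : ContMDiff I 𝓘(ℝ, ℝ) ∞ f) (v : E) :
    mfderiv I 𝓘(ℝ, ℝ) f p v = fderiv ℝ (f ∘ (extChartAt I p).symm) (extChartAt I p p) v := by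
  rw [(hf.mdifferentiableAt (by simp)).mfderiv, I.range_eq_univ, fderivWithin_univ]
  rfl

lemma gradSq_eq (hf : ContMDiff I 𝓘(ℝ, ℝ) ∞ f) :
    g.gradSq f p = fderiv ℝ (f ∘ (extChartAt I p).symm) (extChartAt I p p)
      (Coord.gradient (inChart I g.form p) (f ∘ (extChartAt I p).symm) (extChartAt I p p)) := by
  have hgrad : ∀ v, g.form p (g.grad f p) v = mfderiv I 𝓘(ℝ, ℝ) f p v := fun v =>
    LinearMap.BilinForm.apply_toDual_symm_apply _ v
  have h : g.grad f p = Coord.gradient (inChart I g.form p) (f ∘ (extChartAt I p).symm)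
      (extChartAt I p p) := by
    apply (g.isInvertible_inChart_self p).injective
    ext v
    rw [(g.isMetricAt_inChart p).apply_gradient, ← mfderiv_eq_fderiv_chart hf]
    exact (g.inChart_self p _ v).trans (hgrad v)
  refine (hgrad _).trans ((mfderiv_eq_fderiv_chart hf _).trans ?_)
  rw [h]

end PseudoRiemannianMetric

/-! ## Ricci tensor and Hessian of warped products -/

section Products

variable {E : Type*} [NormedAddCommGroup E] [NormedSpace ℝ E] [FiniteDimensional ℝ E]
  {H : Type*} [TopologicalSpace H] {I : ModelWithCorners ℝ E H}
  {M : Type*} [TopologicalSpace M] [ChartedSpace H M]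
  {E' : Type*} [NormedAddCommGroup E'] [NormedSpace ℝ E'] [FiniteDimensional ℝ E']
  {H' : Type*} [TopologicalSpace H'] {J : ModelWithCorners ℝ E' H'}
  {N : Type*} [TopologicalSpace N] [ChartedSpace H' N]

omit [FiniteDimensional ℝ E] [FiniteDimensional ℝ E'] in
lemma pullFst_apply (p : M × N) (b : LinearMap.BilinForm ℝ (TangentSpace I p.1)) (v w : E × E') :
    pullFst I J p b v w = b v.1 w.1 := by
  unfold pullFst
  rw [mfderiv_fst]
  rfl

omit [FiniteDimensional ℝ E] [FiniteDimensional ℝ E'] in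
lemma pullSnd_apply (p : M × N) (b : LinearMap.BilinForm ℝ (TangentSpace J p.2)) (v w : E × E') :
    pullSnd I J p b v w = b v.2 w.2 := by
  unfold pullSnd
  rw [mfderiv_snd]
  rfl

-- Evaluation on pairs $(v,0)$ and $(0,v)$ recovers the blocks. This is what separates the Einstein
-- equation into one equation per factor.
omit [FiniteDimensional ℝ E] [FiniteDimensional ℝ E'] in
lemma pullFst_add_pullSnd_inj {p : M × N} {b b' : LinearMap.BilinForm ℝ (TangentSpace I p.1)}
    {c c' : LinearMap.BilinForm ℝ (TangentSpace J p.2)} :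
    pullFst I J p b + pullSnd I J p c = pullFst I J p b' + pullSnd I J p c' ↔
      b = b' ∧ c = c' := by
  refine ⟨fun h => ⟨?_, ?_⟩, fun h => by rw [h.1, h.2]⟩
  · refine LinearMap.ext₂ fun v w => ?_
    have h' : pullFst I J p b ((v, 0) : E × E') ((w, 0) : E × E')
          + pullSnd I J p c ((v, 0) : E × E') ((w, 0) : E × E')
        = pullFst I J p b' ((v, 0) : E × E') ((w, 0) : E × E')
          + pullSnd I J p c' ((v, 0) : E × E') ((w, 0) : E × E') :=
      LinearMap.congr_fun₂ h _ _
    rw [pullFst_apply, pullFst_apply, pullSnd_apply, pullSnd_apply] at h'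
    have e : ∀ c : LinearMap.BilinForm ℝ (TangentSpace J p.2), c (0 : E') (0 : E') = 0 :=
      fun c => map_zero _
    rw [e, e, add_zero, add_zero] at h'
    exact h'
  · refine LinearMap.ext₂ fun v w => ?_
    have h' : pullFst I J p b ((0, v) : E × E') ((0, w) : E × E')
          + pullSnd I J p c ((0, v) : E × E') ((0, w) : E × E')
        = pullFst I J p b' ((0, v) : E × E') ((0, w) : E × E')
          + pullSnd I J p c' ((0, v) : E × E') ((0, w) : E × E') :=
      LinearMap.congr_fun₂ h _ _
    rw [pullFst_apply, pullFst_apply, pullSnd_apply, pullSnd_apply] at h'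
    have e : ∀ b : LinearMap.BilinForm ℝ (TangentSpace I p.1), b (0 : E) (0 : E) = 0 :=
      fun b => map_zero _
    rw [e, e, zero_add, zero_add] at h'
    exact h'

lemma metricTrace_pull (p : M × N) {a b : LinearMap.BilinForm ℝ (TangentSpace I p.1)}
    {c e : LinearMap.BilinForm ℝ (TangentSpace J p.2)} (ha : a.Nondegenerate)
    (hc : c.Nondegenerate) :
    metricTrace (pullFst I J p a + pullSnd I J p c) (pullFst I J p b + pullSnd I J p e)
      = metricTrace a b + metricTrace c e := by
  unfold pullFst pullSnd
  rw [mfderiv_fst, mfderiv_snd]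
  exact metricTrace_prod (V := TangentSpace I p.1) (W := TangentSpace J p.2) ha hc b

variable [I.Boundaryless] [J.Boundaryless] [IsManifold I ∞ M] [IsManifold J ∞ N]
  (g : PseudoRiemannianMetric I M) (h : PseudoRiemannianMetric J N) (f : PosFun I M) (p : M × N)

/-- Bridge from manifolds to coordinates: the chart of a product is the product of the charts, so
the components keep the warped shape on the whole chart target. -/
lemma isWarpedAt_inChart :
    Coord.IsWarpedAt (inChart I g.form p.1) (f ∘ (extChartAt I p.1).symm) (inChart J h.form p.2)
      (inChart (I.prod J) (warped g f h).form p) (extChartAt (I.prod J) p p) where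
  base := by
    rw [extChartAt_prod]
    exact g.isMetricAt_inChart p.1
  fiber := by
    rw [extChartAt_prod]
    exact h.isMetricAt_inChart p.2
  total := (warped g f h).isMetricAt_inChart p
  contDiffAt := by
    rw [extChartAt_prod]
    exact PseudoRiemannianMetric.contDiffAt_comp_extChartAt_symm f.smooth
  ne_zero := (f.pos _).ne'
  eventually_eq := by
    filter_upwards [extChartAt_target_mem_nhds p] with x hx u v
    exact inChart_warpedForm g f h p x u v hx

/-- The Ricci tensor of a warped product `(M, g) ×_f (N, h)`. -/
theorem ricci_warped : (warped g f h).ricci p =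
    pullFst I J p (g.ricci p.1 - (finrank ℝ E' / f p.1) • g.hessian f p.1)
      + pullSnd I J p (h.ricci p.2 - (f p.1 * g.laplacian f p.1
        + ((finrank ℝ E' : ℝ) - 1) * g.gradSq f p.1) • h.form p.2) := by
  refine LinearMap.ext₂ fun v w => ?_
  have e : extChartAt (I.prod J) p p = (extChartAt I p.1 p.1, extChartAt J p.2 p.2) := by
    rw [extChartAt_prod]
    rfl
  have hw := isWarpedAt_inChart g h f p
  rw [e] at hw
  have key : ∀ v w : E × E', (warped g f h).ricci p v w =
      g.ricci p.1 v.1 w.1 - finrank ℝ E' / f p.1 * g.hessian f p.1 v.1 w.1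
        + (h.ricci p.2 v.2 w.2 - (f p.1 * g.laplacian f p.1
          + ((finrank ℝ E' : ℝ) - 1) * g.gradSq f p.1) * h.form p.2 v.2 w.2) := by
    intro v w
    have hp : (f ∘ (extChartAt I p.1).symm) (extChartAt I p.1 p.1) = f p.1 :=
      congrArg f (extChartAt_to_inv p.1)
    rw [PseudoRiemannianMetric.ricci_apply, e, hw.ricci_apply, g.laplacian_eq f.smooth,
      g.gradSq_eq f.smooth, ← hp, g.ricci_apply p.1, h.ricci_apply p.2, g.hessian_apply p.1,
      ← h.inChart_self p.2]
  refine (key v w).trans ?_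
  exact (congrArg₂ (· + ·)
    (pullFst_apply (I := I) (J := J) p (g.ricci p.1 - (finrank ℝ E' / f p.1) • g.hessian f p.1) v w)
    (pullSnd_apply (I := I) (J := J) p (h.ricci p.2 - (f p.1 * g.laplacian f p.1
        + ((finrank ℝ E' : ℝ) - 1) * g.gradSq f p.1) • h.form p.2) v w)).symm

variable {g h f p}

omit [I.Boundaryless] in
lemma hessian_one (q : M) : g.hessian (PosFun.one : PosFun I M) q = 0 := by
  refine LinearMap.ext₂ fun v w => ?_
  have : ((PosFun.one : PosFun I M) : M → ℝ) ∘ (extChartAt I q).symm = fun _ => (1 : ℝ) := rfl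
  refine (g.hessian_apply q _ v w).trans ?_
  rw [this]
  refine (Coord.hessian_apply _ _ _ _ _).trans ?_
  rw [fderiv_fun_const]
  simp
  rfl

omit [I.Boundaryless] [IsManifold I ∞ M] in
lemma gradSq_one (q : M) : g.gradSq (PosFun.one : PosFun I M) q = 0 := by
  have h0 : mfderiv I 𝓘(ℝ, ℝ) (PosFun.one : PosFun I M) q = 0 := mfderiv_const
  have h : g.grad (PosFun.one : PosFun I M) q = 0 := by
    rw [PseudoRiemannianMetric.grad, h0]
    exact map_zero _
  rw [PseudoRiemannianMetric.gradSq, h, map_zero]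

omit [I.Boundaryless] in
lemma laplacian_one (q : M) : g.laplacian (PosFun.one : PosFun I M) q = 0 := by
  rw [PseudoRiemannianMetric.laplacian, hessian_one, metricTrace_zero]

variable (g h f p)

lemma form_prodMetric : (prodMetric g h).form p
    = pullFst I J p (g.form p.1) + pullSnd I J p (h.form p.2) := by
  change pullFst I J p (g.form p.1) + (1 : ℝ) ^ 2 • pullSnd I J p (h.form p.2) = _
  rw [one_pow, one_smul]

/-- Warping by the constant `1` removes every derivative term of `ricci_warped`. -/
theorem ricci_prodMetric : (prodMetric g h).ricci p
    = pullFst I J p (g.ricci p.1) + pullSnd I J p (h.ricci p.2) := by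
  rw [prodMetric, ricci_warped, hessian_one, laplacian_one, gradSq_one]
  simp

theorem hessian_prodMetric_sum (f' : PosFun J N) : (prodMetric g h).hessian (f.sum f') p
    = pullFst I J p (g.hessian f p.1) + pullSnd I J p (h.hessian f' p.2) := by
  refine LinearMap.ext₂ fun v w => ?_
  have e : extChartAt (I.prod J) p p = (extChartAt I p.1 p.1, extChartAt J p.2 p.2) := by
    rw [extChartAt_prod]
    rfl
  have hw := isWarpedAt_inChart g h PosFun.one p
  rw [e] at hw
  have ef : (f.sum f') ∘ (extChartAt (I.prod J) p).symm = fun w : E × E' =>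
      (f ∘ (extChartAt I p.1).symm) w.1 + (f' ∘ (extChartAt J p.2).symm) w.2 := by
    rw [extChartAt_prod]
    rfl
  have key : ∀ v w : E × E', (prodMetric g h).hessian (f.sum f') p v w
      = g.hessian f p.1 v.1 w.1 + h.hessian f' p.2 v.2 w.2 := by
    intro v w
    rw [PseudoRiemannianMetric.hessian_apply, g.hessian_apply p.1, h.hessian_apply p.2, ef, e]
    exact hw.hessian_add (Filter.Eventually.of_forall fun _ => rfl)
      (PseudoRiemannianMetric.contDiffAt_comp_extChartAt_symm f.smooth)
      (PseudoRiemannianMetric.contDiffAt_comp_extChartAt_symm f'.smooth) v w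
  refine (key v w).trans ?_
  exact (congrArg₂ (· + ·) (pullFst_apply (I := I) (J := J) p _ v w)
    (pullSnd_apply (I := I) (J := J) p _ v w)).symm

theorem laplacian_prodMetric_sum (f' : PosFun J N) : (prodMetric g h).laplacian (f.sum f') p
    = g.laplacian f p.1 + h.laplacian f' p.2 := by
  rw [PseudoRiemannianMetric.laplacian, hessian_prodMetric_sum, form_prodMetric,
    metricTrace_pull p (g.nondegenerate _) (h.nondegenerate _)]
  rfl

theorem scal_prodMetric : (prodMetric g h).scal p = g.scal p.1 + h.scal p.2 := by
  rw [PseudoRiemannianMetric.scal, ricci_prodMetric, form_prodMetric,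
    metricTrace_pull p (g.nondegenerate _) (h.nondegenerate _)]
  rfl

end Products

/-- The chart of $\mathbb R^d$ is the identity, so the components are constant. The fiber equation
$\ddot{Ric}=0$ in (T) and (S) is thus automatic. -/
lemma DerivedFiber.ricci_metric {d : ℕ} (F : DerivedFiber d) (z : EuclideanSpace ℝ (Fin d)) :
    F.metric.ricci z = 0 := by
  have hc : ∀ y u v, inChart (𝓡 d) F.metric.form z y u v = -(inner ℝ u v) := by
    intro y u v
    have h : mfderiv 𝓘(ℝ, EuclideanSpace ℝ (Fin d)) (𝓡 d) (extChartAt (𝓡 d) z).symm y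
        = ContinuousLinearMap.id ℝ _ := by
      rw [extChartAt_model_space_eq_id]
      exact mfderiv_id (I := 𝓡 d)
    rw [PseudoRiemannianMetric.inChart_apply, h]
    rfl
  refine LinearMap.ext₂ fun v w => ?_
  refine (F.metric.ricci_apply z v w).trans ?_
  rw [Coord.ricci_eq_zero_of_eventually_const]
  · rfl
  · refine Filter.Eventually.of_forall fun y => ?_
    ext u v
    rw [hc, hc]

/-! ### The three blocks of the Einstein equation and their traces. -/

section PNDP

variable {E₁ : Type*} [NormedAddCommGroup E₁] [NormedSpace ℝ E₁] [FiniteDimensional ℝ E₁]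
  {H₁ : Type*} [TopologicalSpace H₁] {I₁ : ModelWithCorners ℝ E₁ H₁} [I₁.Boundaryless]
  {B₁ : Type*} [TopologicalSpace B₁] [ChartedSpace H₁ B₁] [IsManifold I₁ ∞ B₁]
  {E₂ : Type*} [NormedAddCommGroup E₂] [NormedSpace ℝ E₂] [FiniteDimensional ℝ E₂]
  {H₂ : Type*} [TopologicalSpace H₂] {I₂ : ModelWithCorners ℝ E₂ H₂} [I₂.Boundaryless]
  {B₂ : Type*} [TopologicalSpace B₂] [ChartedSpace H₂ B₂] [IsManifold I₂ ∞ B₂]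
  {d : ℕ} (g₁ : PseudoRiemannianMetric I₁ B₁) (g₂ : PseudoRiemannianMetric I₂ B₂)
  (f₁ : PosFun I₁ B₁) (f₂ : PosFun I₂ B₂) (F : DerivedFiber d) (lam : ℝ)

/-- The coefficient of the fiber metric in the Ricci tensor of the total space. -/
def fiberCoeff (d : ℕ) (p : B₁ × B₂) : ℝ :=
  f₁.sum f₂ p * (g₁.laplacian f₁ p.1 + g₂.laplacian f₂ p.2)
    + ((d : ℝ) - 1) * (prodMetric g₁ g₂).gradSq (f₁.sum f₂) p

lemma form_pndpMetric (p : (B₁ × B₂) × EuclideanSpace ℝ (Fin d)) :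
    (pndpMetric g₁ g₂ f₁ f₂ F).form p =
      pullFst (I₁.prod I₂) (𝓡 d) p
        (pullFst I₁ I₂ p.1 (g₁.form p.1.1) + pullSnd I₁ I₂ p.1 (g₂.form p.1.2))
      + pullSnd (I₁.prod I₂) (𝓡 d) p (f₁.sum f₂ p.1 ^ 2 • F.metric.form p.2) := by
  rw [← form_prodMetric]
  rfl

lemma ricci_pndpMetric (p : (B₁ × B₂) × EuclideanSpace ℝ (Fin d)) :
    (pndpMetric g₁ g₂ f₁ f₂ F).ricci p =
      pullFst (I₁.prod I₂) (𝓡 d) p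
        (pullFst I₁ I₂ p.1 (g₁.ricci p.1.1 - ((d : ℝ) / f₁.sum f₂ p.1) • g₁.hessian f₁ p.1.1)
        + pullSnd I₁ I₂ p.1 (g₂.ricci p.1.2 - ((d : ℝ) / f₁.sum f₂ p.1) • g₂.hessian f₂ p.1.2))
      + pullSnd (I₁.prod I₂) (𝓡 d) p (-(fiberCoeff g₁ g₂ f₁ f₂ d p.1) • F.metric.form p.2) := by
  rw [pndpMetric, ricci_warped, ricci_prodMetric, hessian_prodMetric_sum,
    laplacian_prodMetric_sum, F.ricci_metric, finrank_euclideanSpace_fin, zero_sub, neg_smul]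
  congr 2
  refine LinearMap.ext₂ fun v w => ?_
  simp only [LinearMap.sub_apply, LinearMap.add_apply, LinearMap.smul_apply, pullFst, pullSnd,
    LinearMap.BilinForm.comp_apply, smul_add]
  abel

lemma einstein_pndpMetric_iff (hd : 0 < d) :
    (pndpMetric g₁ g₂ f₁ f₂ F).IsEinstein lam ↔ ∀ x y,
      g₁.ricci x - ((d : ℝ) / f₁.sum f₂ (x, y)) • g₁.hessian f₁ x = lam • g₁.form x ∧
      g₂.ricci y - ((d : ℝ) / f₁.sum f₂ (x, y)) • g₂.hessian f₂ y = lam • g₂.form y ∧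
      fiberCoeff g₁ g₂ f₁ f₂ d (x, y) + lam * f₁.sum f₂ (x, y) ^ 2 = 0 := by
  have hs : ∀ p : (B₁ × B₂) × EuclideanSpace ℝ (Fin d),
      lam • (pndpMetric g₁ g₂ f₁ f₂ F).form p = pullFst (I₁.prod I₂) (𝓡 d) p
        (pullFst I₁ I₂ p.1 (lam • g₁.form p.1.1) + pullSnd I₁ I₂ p.1 (lam • g₂.form p.1.2))
      + pullSnd (I₁.prod I₂) (𝓡 d) p ((lam * f₁.sum f₂ p.1 ^ 2) • F.metric.form p.2) := by
    intro p
    rw [form_pndpMetric, mul_smul]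
    refine LinearMap.ext₂ fun v w => ?_
    simp only [LinearMap.add_apply, LinearMap.smul_apply, pullFst, pullSnd,
      LinearMap.BilinForm.comp_apply, smul_add]
  -- Tracing with the fiber metric gives $-ad=bd$, and $d>0$ cancels; for $d=0$ the fiber block
  -- would carry no information.
  have hc : ∀ (a b : ℝ) (z : EuclideanSpace ℝ (Fin d)),
      -a • F.metric.form z = b • F.metric.form z ↔ a + b = 0 := by
    intro a b z
    refine ⟨fun h => ?_, fun h => by rw [eq_neg_of_add_eq_zero_right h]⟩
    have := congrArg (metricTrace (F.metric.form z)) h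
    rw [metricTrace_smul, metricTrace_smul, metricTrace_self (F.metric.nondegenerate z)] at this
    have hd' : (finrank ℝ (TangentSpace (𝓡 d) z) : ℝ) ≠ 0 := by
      have : finrank ℝ (TangentSpace (𝓡 d) z) = d := finrank_euclideanSpace_fin
      rw [this]
      exact_mod_cast hd.ne'
    linarith [mul_right_cancel₀ hd' this]
  unfold PseudoRiemannianMetric.IsEinstein
  simp only [hs, ricci_pndpMetric, pullFst_add_pullSnd_inj, hc]
  exact ⟨fun h x y => ⟨(h ((x, y), 0)).1.1, (h ((x, y), 0)).1.2, (h ((x, y), 0)).2⟩,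
    fun h p => ⟨⟨(h p.1.1 p.1.2).1, (h p.1.1 p.1.2).2.1⟩, (h p.1.1 p.1.2).2.2⟩⟩

lemma einstein_iff_tensorSystem [Nonempty B₁] (hd : 0 < d) :
    (g₂.IsEinstein lam ∧ (pndpMetric g₁ g₂ f₁ f₂ F).IsEinstein lam) ↔
      TensorSystem g₁ g₂ f₁ f₂ F lam := by
  rw [einstein_pndpMetric_iff g₁ g₂ f₁ f₂ F lam hd]
  have hd' : (d : ℝ) ≠ 0 := by exact_mod_cast hd.ne'
  constructor
  · rintro ⟨h₂, h⟩
    have hh : ∀ y, g₂.hessian f₂ y = 0 := by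
      intro y
      -- The Hessian at `y` does not involve `x`, but its coefficient $d/f(x,y)$ does; any point of
      -- $B'$ serves, the coefficient being nonzero.
      obtain ⟨x⟩ := ‹Nonempty B₁›
      have h' := (h x y).2.1
      rw [h₂ y, sub_eq_self, smul_eq_zero] at h'
      exact h'.resolve_left (div_ne_zero hd' ((f₁.sum f₂).pos _).ne')
    refine ⟨fun x y => (h x y).1, hh, h₂, F.ricci_metric, fun x y => ?_⟩
    have hl : g₂.laplacian f₂ y = 0 := by
      rw [PseudoRiemannianMetric.laplacian, hh, metricTrace_zero]
    have h' := (h x y).2.2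
    rwa [fiberCoeff, hl, add_zero] at h'
  · intro h
    refine ⟨h.ricci_snd, fun x y => ⟨h.ricci_fst x y, ?_, ?_⟩⟩
    · rw [h.hessian_snd, smul_zero, sub_zero, h.ricci_snd]
    · have hl : g₂.laplacian f₂ y = 0 := by
        rw [PseudoRiemannianMetric.laplacian, h.hessian_snd, metricTrace_zero]
      rw [fiberCoeff, hl, add_zero]
      exact h.warping x y

/-- The scalar curvature of the total space. -/
lemma scal_pndpMetric (p : (B₁ × B₂) × EuclideanSpace ℝ (Fin d)) :
    (pndpMetric g₁ g₂ f₁ f₂ F).scal p =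
      (g₁.scal p.1.1 - d / f₁.sum f₂ p.1 * g₁.laplacian f₁ p.1.1)
      + (g₂.scal p.1.2 - d / f₁.sum f₂ p.1 * g₂.laplacian f₂ p.1.2)
      - d / f₁.sum f₂ p.1 ^ 2 * fiberCoeff g₁ g₂ f₁ f₂ d p.1 := by
  have hf : f₁.sum f₂ p.1 ^ 2 ≠ 0 := pow_ne_zero 2 ((f₁.sum f₂).pos _).ne'
  have hB : (pullFst I₁ I₂ p.1 (g₁.form p.1.1)
      + pullSnd I₁ I₂ p.1 (g₂.form p.1.2)).Nondegenerate := by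
    rw [← form_prodMetric]
    exact (prodMetric g₁ g₂).nondegenerate p.1
  have hF := F.metric.nondegenerate p.2
  have hF' : (f₁.sum f₂ p.1 ^ 2 • F.metric.form p.2).Nondegenerate :=
    ⟨fun v hv => hF.1 v fun w => (mul_eq_zero.1 (hv w)).resolve_left hf,
      fun v hv => hF.2 v fun w => (mul_eq_zero.1 (hv w)).resolve_left hf⟩
  have hdim : finrank ℝ (TangentSpace (𝓡 d) p.2) = d := finrank_euclideanSpace_fin
  rw [PseudoRiemannianMetric.scal, ricci_pndpMetric, form_pndpMetric, metricTrace_pull p hB hF',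
    metricTrace_pull p.1 (g₁.nondegenerate _) (g₂.nondegenerate _), metricTrace_sub,
    metricTrace_sub, metricTrace_smul, metricTrace_smul, metricTrace_smul,
    metricTrace_smul_left hF hf, metricTrace_self hF, hdim]
  change (g₁.scal p.1.1 - d / f₁.sum f₂ p.1 * g₁.laplacian f₁ p.1.1)
      + (g₂.scal p.1.2 - d / f₁.sum f₂ p.1 * g₂.laplacian f₂ p.1.2) + _ = _
  ring

/-- The inclusion of the factor has derivative $v\mapsto((v,0),0)$, so pulling back a block diagonal
form keeps exactly the block of $B'$. -/
lemma contractedRicci_fst (x : B₁) (y : B₂) (z : EuclideanSpace ℝ (Fin d)) :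
    contractedRicci (J := I₁) (pndpMetric g₁ g₂ f₁ f₂ F) (fun x' => ((x', y), z)) x
      = g₁.scal x - d / f₁.sum f₂ (x, y) * g₁.laplacian f₁ x := by
  have hι : mfderiv I₁ ((I₁.prod I₂).prod (𝓡 d))
      (fun x' : B₁ => ((x', y), z)) x
      = ((ContinuousLinearMap.id ℝ E₁).prod (0 : E₁ →L[ℝ] E₂)).prod
        (0 : E₁ →L[ℝ] EuclideanSpace ℝ (Fin d)) :=
    (((hasMFDerivAt_id x).prodMk (hasMFDerivAt_const y x)).prodMk (hasMFDerivAt_const z x)).mfderiv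
  have hp : ∀ (b₁ : LinearMap.BilinForm ℝ (TangentSpace I₁ x))
      (b₂ : LinearMap.BilinForm ℝ (TangentSpace I₂ y))
      (b₃ : LinearMap.BilinForm ℝ (TangentSpace (𝓡 d) z)),
      pullForm (pullFst (I₁.prod I₂) (𝓡 d) ((x, y), z)
        (pullFst I₁ I₂ (x, y) b₁ + pullSnd I₁ I₂ (x, y) b₂)
        + pullSnd (I₁.prod I₂) (𝓡 d) ((x, y), z) b₃)
        (mfderiv I₁ ((I₁.prod I₂).prod (𝓡 d))
          (fun x' : B₁ => ((x', y), z)) x).toLinearMap = b₁ := by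
    intro b₁ b₂ b₃
    rw [hι]
    refine LinearMap.ext₂ fun u v => ?_
    unfold pullFst pullSnd
    rw [mfderiv_fst, mfderiv_snd, mfderiv_fst, mfderiv_snd]
    change b₁ u v + b₂ 0 0 + b₃ 0 0 = b₁ u v
    rw [map_zero, map_zero]
    simp
  rw [contractedRicci, form_pndpMetric, ricci_pndpMetric, hp, hp, metricTrace_sub,
    metricTrace_smul]
  rfl

lemma contractedRicci_snd (x : B₁) (y : B₂) (z : EuclideanSpace ℝ (Fin d)) :
    contractedRicci (J := I₂) (pndpMetric g₁ g₂ f₁ f₂ F) (fun y' => ((x, y'), z)) y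
      = g₂.scal y - d / f₁.sum f₂ (x, y) * g₂.laplacian f₂ y := by
  have hι : mfderiv I₂ ((I₁.prod I₂).prod (𝓡 d))
      (fun y' : B₂ => ((x, y'), z)) y
      = ((0 : E₂ →L[ℝ] E₁).prod (ContinuousLinearMap.id ℝ E₂)).prod
        (0 : E₂ →L[ℝ] EuclideanSpace ℝ (Fin d)) :=
    (((hasMFDerivAt_const x y).prodMk (hasMFDerivAt_id y)).prodMk (hasMFDerivAt_const z y)).mfderiv
  have hp : ∀ (b₁ : LinearMap.BilinForm ℝ (TangentSpace I₁ x))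
      (b₂ : LinearMap.BilinForm ℝ (TangentSpace I₂ y))
      (b₃ : LinearMap.BilinForm ℝ (TangentSpace (𝓡 d) z)),
      pullForm (pullFst (I₁.prod I₂) (𝓡 d) ((x, y), z)
        (pullFst I₁ I₂ (x, y) b₁ + pullSnd I₁ I₂ (x, y) b₂)
        + pullSnd (I₁.prod I₂) (𝓡 d) ((x, y), z) b₃)
        (mfderiv I₂ ((I₁.prod I₂).prod (𝓡 d))
          (fun y' : B₂ => ((x, y'), z)) y).toLinearMap = b₂ := by
    intro b₁ b₂ b₃
    rw [hι]
    refine LinearMap.ext₂ fun u v => ?_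
    unfold pullFst pullSnd
    rw [mfderiv_fst, mfderiv_snd, mfderiv_fst, mfderiv_snd]
    change b₁ 0 0 + b₂ u v + b₃ 0 0 = b₂ u v
    rw [map_zero, map_zero]
    simp
  rw [contractedRicci, form_pndpMetric, ricci_pndpMetric, hp, hp, metricTrace_sub,
    metricTrace_smul]
  rfl

lemma contractedRicci_fiber (x : B₁) (y : B₂) (z : EuclideanSpace ℝ (Fin d)) :
    contractedRicci (J := 𝓡 d) (pndpMetric g₁ g₂ f₁ f₂ F) (fun z' => ((x, y), z')) z
      = -(d / f₁.sum f₂ (x, y) ^ 2 * fiberCoeff g₁ g₂ f₁ f₂ d (x, y)) := by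
  have hι : mfderiv (𝓡 d) ((I₁.prod I₂).prod (𝓡 d))
      (fun z' : EuclideanSpace ℝ (Fin d) => ((x, y), z')) z
      = (0 : EuclideanSpace ℝ (Fin d) →L[ℝ] E₁ × E₂).prod
        (ContinuousLinearMap.id ℝ (EuclideanSpace ℝ (Fin d))) :=
    ((hasMFDerivAt_const (x, y) z).prodMk (hasMFDerivAt_id z)).mfderiv
  have hp : ∀ (b : LinearMap.BilinForm ℝ (TangentSpace (I₁.prod I₂) (x, y)))
      (b₃ : LinearMap.BilinForm ℝ (TangentSpace (𝓡 d) z)),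
      pullForm (pullFst (I₁.prod I₂) (𝓡 d) ((x, y), z) b
        + pullSnd (I₁.prod I₂) (𝓡 d) ((x, y), z) b₃)
        (mfderiv (𝓡 d) ((I₁.prod I₂).prod (𝓡 d))
          (fun z' : EuclideanSpace ℝ (Fin d) => ((x, y), z')) z).toLinearMap = b₃ := by
    intro b b₃
    rw [hι]
    refine LinearMap.ext₂ fun u v => ?_
    unfold pullFst pullSnd
    rw [mfderiv_fst, mfderiv_snd]
    change b 0 0 + b₃ u v = b₃ u v
    rw [map_zero]
    simp
  have hf : f₁.sum f₂ (x, y) ^ 2 ≠ 0 := pow_ne_zero 2 ((f₁.sum f₂).pos _).ne'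
  have hF := F.metric.nondegenerate z
  have hdim : finrank ℝ (TangentSpace (𝓡 d) z) = d := finrank_euclideanSpace_fin
  rw [contractedRicci, form_pndpMetric, ricci_pndpMetric, hp, hp, metricTrace_smul,
    metricTrace_smul_left hF hf, metricTrace_self hF, hdim]
  ring

lemma scalarSystem_of_tensorSystem (h : TensorSystem g₁ g₂ f₁ f₂ F lam) :
    ScalarSystem g₁ g₂ f₁ f₂ F lam d where
  scal_fst x y := by
    have hf : f₁.sum f₂ (x, y) ≠ 0 := ((f₁.sum f₂).pos _).ne'
    have e := congrArg (metricTrace (g₁.form x)) (h.ricci_fst x y)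
    rw [metricTrace_sub, metricTrace_smul, metricTrace_smul,
      metricTrace_self (g₁.nondegenerate x)] at e
    change g₁.scal x - d / f₁.sum f₂ (x, y) * g₁.laplacian f₁ x = lam * finrank ℝ E₁ at e
    field_simp at e
    linarith
  laplacian_snd y := by
    rw [PseudoRiemannianMetric.laplacian, h.hessian_snd, metricTrace_zero]
  scal_snd y := by
    rw [PseudoRiemannianMetric.scal, h.ricci_snd, metricTrace_smul,
      metricTrace_self (g₂.nondegenerate y)]
    rfl
  ricci_fiber := h.ricci_fiber
  warping := h.warping

/-- Scalar copy of `einstein_iff_tensorSystem`: $\widetilde R=\lambda\widetilde n$ turns the middle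
trace into $\frac df\widetilde\Delta\widetilde f=0$, and the other two traces become the remaining
equations. -/
lemma contractedEinstein_iff_scalarSystem [Nonempty B₁] (hd : 0 < d) :
    ((∀ y, g₂.scal y = lam * finrank ℝ E₂) ∧ ContractedEinstein g₁ g₂ f₁ f₂ F lam) ↔
      ScalarSystem g₁ g₂ f₁ f₂ F lam d := by
  have hd' : (d : ℝ) ≠ 0 := by exact_mod_cast hd.ne'
  have hf : ∀ p, f₁.sum f₂ p ≠ 0 := fun p => ((f₁.sum f₂).pos p).ne'
  constructor
  · rintro ⟨hs, h⟩
    have hl : ∀ y, g₂.laplacian f₂ y = 0 := by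
      intro y
      obtain ⟨x⟩ := ‹Nonempty B₁›
      have e := h.snd x y 0
      rw [contractedRicci_snd, hs, sub_eq_self, mul_eq_zero] at e
      exact e.resolve_left (div_ne_zero hd' (hf _))
    refine ⟨fun x y => ?_, hl, hs, F.ricci_metric, fun x y => ?_⟩
    · have e := h.fst x y 0
      have hf' := hf (x, y)
      rw [contractedRicci_fst] at e
      field_simp at e
      linarith
    · have e := h.fiber x y 0
      have hf' := hf (x, y)
      rw [contractedRicci_fiber, fiberCoeff, hl, add_zero] at e
      field_simp at e
      linarith
  · intro h
    refine ⟨h.scal_snd, ⟨fun x y z => ?_, fun x y z => ?_, fun x y z => ?_⟩⟩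
    · have hf' := hf (x, y)
      rw [contractedRicci_fst]
      field_simp
      linarith [h.scal_fst x y]
    · rw [contractedRicci_snd, h.laplacian_snd, h.scal_snd]
      ring
    · have hf' := hf (x, y)
      rw [contractedRicci_fiber, fiberCoeff, h.laplacian_snd, add_zero]
      field_simp
      linarith [h.warping x y]

/-- With $R=R'+\widetilde R$ and $\Delta f=\Delta'f'$, the base equation is $f$ times the first
equation of (S), and the fiber equation is $d$ times the last. Both factors are nonzero. -/
lemma warpedScalarEquations_iff_scalarSystem (hd : 0 < d)
    (hs : ∀ y, g₂.scal y = lam * finrank ℝ E₂) (hl : ∀ y, g₂.laplacian f₂ y = 0) :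
    WarpedScalarEquations g₁ g₂ f₁ f₂ d lam ↔ ScalarSystem g₁ g₂ f₁ f₂ F lam d := by
  have hd' : (d : ℝ) ≠ 0 := by exact_mod_cast hd.ne'
  have hf : ∀ p, f₁.sum f₂ p ≠ 0 := fun p => ((f₁.sum f₂).pos p).ne'
  constructor
  · intro h
    refine ⟨fun x y => ?_, hl, hs, F.ricci_metric, fun x y => ?_⟩
    · have e := h.base (x, y)
      rw [scal_prodMetric, laplacian_prodMetric_sum, hs, hl] at e
      refine mul_left_cancel₀ (hf (x, y)) ?_
      linear_combination e
    · have e := h.fiber (x, y)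
      rw [laplacian_prodMetric_sum, hl] at e
      refine mul_left_cancel₀ hd' ?_
      linear_combination e
  · intro h
    refine ⟨fun p => ?_, fun p => ?_⟩
    · rw [scal_prodMetric, laplacian_prodMetric_sum, hs, hl]
      linear_combination f₁.sum f₂ p * h.scal_fst p.1 p.2
    · rw [laplacian_prodMetric_sum, hl]
      linear_combination (d : ℝ) * h.warping p.1 p.2

lemma ScalarSystem.scal_pndpMetric {g₁ : PseudoRiemannianMetric I₁ B₁}
    {g₂ : PseudoRiemannianMetric I₂ B₂} {f₁ : PosFun I₁ B₁} {f₂ : PosFun I₂ B₂}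
    {F : DerivedFiber d} {lam : ℝ} (h : ScalarSystem g₁ g₂ f₁ f₂ F lam d)
    (p : (B₁ × B₂) × EuclideanSpace ℝ (Fin d)) :
    (pndpMetric g₁ g₂ f₁ f₂ F).scal p = lam * (finrank ℝ E₁ + finrank ℝ E₂ + d) := by
  have hf : f₁.sum f₂ p.1 ≠ 0 := ((f₁.sum f₂).pos _).ne'
  have e₁ := h.scal_fst p.1.1 p.1.2
  have e₂ := h.warping p.1.1 p.1.2
  rw [_root_.scal_pndpMetric, fiberCoeff, h.laplacian_snd, h.scal_snd]
  field_simp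
  -- After multiplication by $f^2$, the first equation of (S) contributes $\lambda n'$ and the
  -- warping equation $\lambda d$.
  linear_combination f₁.sum f₂ p.1 * e₁ - d * e₂

lemma TensorSystem.ricci_prodMetric {g₁ : PseudoRiemannianMetric I₁ B₁}
    {g₂ : PseudoRiemannianMetric I₂ B₂} {f₁ : PosFun I₁ B₁} {f₂ : PosFun I₂ B₂}
    {F : DerivedFiber d} {lam : ℝ} (h : TensorSystem g₁ g₂ f₁ f₂ F lam) (p : B₁ × B₂) :
    (prodMetric g₁ g₂).ricci p = lam • (prodMetric g₁ g₂).form p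
      + ((d : ℝ) / f₁.sum f₂ p) • pullFst I₁ I₂ p (g₁.hessian f₁ p.1) := by
  have e : g₁.ricci p.1 = lam • g₁.form p.1 + ((d : ℝ) / f₁.sum f₂ p) • g₁.hessian f₁ p.1 :=
    sub_eq_iff_eq_add.1 (h.ricci_fst p.1 p.2)
  rw [_root_.ricci_prodMetric, form_prodMetric, e, h.ricci_snd]
  refine LinearMap.ext₂ fun v w => ?_
  simp only [LinearMap.add_apply, LinearMap.smul_apply, pullFst, pullSnd,
    LinearMap.BilinForm.comp_apply, smul_add]
  abel

end PNDP

end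

theorem mainTheorem2
    -- the first factor `B'` of the base, with its metric
    {E₁ : Type*} [NormedAddCommGroup E₁] [NormedSpace ℝ E₁] [FiniteDimensional ℝ E₁]
    {H₁ : Type*} [TopologicalSpace H₁] {I₁ : ModelWithCorners ℝ E₁ H₁} [I₁.Boundaryless]
    {B₁ : Type*} [TopologicalSpace B₁] [ChartedSpace H₁ B₁] [IsManifold I₁ ∞ B₁] [Nonempty B₁]
    (g₁ : PseudoRiemannianMetric I₁ B₁)
    -- the second factor `B~` of the base, with its metric
    {E₂ : Type*} [NormedAddCommGroup E₂] [NormedSpace ℝ E₂] [FiniteDimensional ℝ E₂]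
    {H₂ : Type*} [TopologicalSpace H₂] {I₂ : ModelWithCorners ℝ E₂ H₂} [I₂.Boundaryless]
    {B₂ : Type*} [TopologicalSpace B₂] [ChartedSpace H₂ B₂] [IsManifold I₂ ∞ B₂] [Nonempty B₂]
    (g₂ : PseudoRiemannianMetric I₂ B₂)
    -- the two summands of the warping function `f(x,y) = f'(x) + f~(y)`
    (f₁ : PosFun I₁ B₁) (f₂ : PosFun I₂ B₂)
    -- the derived fiber `F = ℝᵈ + E`, of negative dimension `m = d - rank E = -d`
    {d : ℕ} (F : DerivedFiber d) (hF : F.virtualDim = -(d : ℤ)) (hneg : F.virtualDim < 0)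
    (lam : ℝ) :
    -- PNDP-manifolds are characterized by the tensorial system
    (IsPNDP g₁ g₂ f₁ f₂ F lam ↔ Normalized g₁ g₂ d lam ∧ TensorSystem g₁ g₂ f₁ f₂ F lam) ∧
    -- the same without the normalizations
    ((g₂.IsEinstein lam ∧ (pndpMetric g₁ g₂ f₁ f₂ F).IsEinstein lam) ↔
      TensorSystem g₁ g₂ f₁ f₂ F lam) ∧
    -- the Ricci tensor of the base
    (TensorSystem g₁ g₂ f₁ f₂ F lam → ∀ p : B₁ × B₂,
      (prodMetric g₁ g₂).ricci p =
        pullFst I₁ I₂ p (g₁.ricci p.1) + pullSnd I₁ I₂ p (g₂.ricci p.2) ∧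
      (prodMetric g₁ g₂).ricci p = lam • (prodMetric g₁ g₂).form p
        + ((d : ℝ) / f₁.sum f₂ p) • pullFst I₁ I₂ p (g₁.hessian f₁ p.1)) ∧
    -- the contracted forms: `k = d` if `n - d ≤ 0`, and `k = n'` if `n - d > 0` and `d = n'`
    (∀ k : ℕ,
      ((finrank ℝ E₁ + finrank ℝ E₂ ≤ d ∧ k = d) ∨
        (d < finrank ℝ E₁ + finrank ℝ E₂ ∧ d = finrank ℝ E₁ ∧ k = finrank ℝ E₁)) →
      (TensorSystem g₁ g₂ f₁ f₂ F lam → ScalarSystem g₁ g₂ f₁ f₂ F lam k) ∧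
      (((∀ y, g₂.scal y = lam * finrank ℝ E₂) ∧ ContractedEinstein g₁ g₂ f₁ f₂ F lam) ↔
        ScalarSystem g₁ g₂ f₁ f₂ F lam k) ∧
      ((∀ y, g₂.scal y = lam * finrank ℝ E₂) → (∀ y, g₂.laplacian f₂ y = 0) →
        (WarpedScalarEquations g₁ g₂ f₁ f₂ d lam ↔ ScalarSystem g₁ g₂ f₁ f₂ F lam k)) ∧
      (ScalarSystem g₁ g₂ f₁ f₂ F lam k → ∀ p, (pndpMetric g₁ g₂ f₁ f₂ F).scal p
        = lam * (finrank ℝ E₁ + finrank ℝ E₂ + d))) := by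
  have hd : 0 < d := by omega
  have hT := einstein_iff_tensorSystem g₁ g₂ f₁ f₂ F lam hd
  refine ⟨⟨fun h => ⟨h.normalized, hT.1 ⟨h.einstein_factor, h.einstein⟩⟩, fun h => ?_⟩, hT,
    fun h p => ⟨ricci_prodMetric g₁ g₂ p, h.ricci_prodMetric p⟩, fun k hk => ?_⟩
  -- From $d-\operatorname{rank}E=-d$ the rank is $2d$, which exceeds $d$ since $d>0$.
  · have hr : d < F.rank := by
      unfold DerivedFiber.virtualDim at hF
      omega
    exact ⟨hr, hF, hneg, h.1, (hT.2 h.2).1, (hT.2 h.2).2⟩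
  -- When $n-d>0$, the assumption $d=n'$ makes $k=n'$ equal to $d$ as well.
  · obtain rfl : k = d := by omega
    exact ⟨scalarSystem_of_tensorSystem g₁ g₂ f₁ f₂ F lam,
      contractedEinstein_iff_scalarSystem g₁ g₂ f₁ f₂ F lam hd,
      warpedScalarEquations_iff_scalarSystem g₁ g₂ f₁ f₂ F lam hd,
      fun h p => h.scal_pndpMetric p⟩
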